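/- Let $\mathcal M$ be the set of all nonincreasing, left-continuous functions $a:[0,1]\to[0,1]$, and let $\mathcal C$ be the set of all twice differentiable functions $\phi:\mathbb R\to\mathbb R$ with $\|\phi'\|_\infty<\infty$ and $\|\phi''\|_\infty<\infty$. For $\phi\in\mathcal C$ and $a\in\mathcal M$, a *solution* with data $(\phi,a)$ is a continuous function $F$ on $\mathbb R\times[0,1]$ such that $F(\cdot,0)=\phi$, $F(\cdot,t)$ is $C^2$ for every $t\in(0,1]$, $\partial_xF$ is bounded on $\mathbb R\times(0,1]$, and $$\partial_tF(x,t)=\tfrac12\left(\partial_{xx}F(x,t)+a(t)\,(\partial_xF(x,t))^2\right),\qquad (x,t)\in\mathbb R\times(0,1],$$ where $\partial_tF(x,t)$ is the left derivative in $t$, and also the two-sided derivative if $t<1$ and $a$ is continuous at $t$. Let $\phi\in\mathcal C$ be convex, and suppose that $\phi$ is nondecreasing or even. Then the following hold. 1. For every step function $b\in\mathcal M$ (that is, $b$ takes finitely many values) there is a solution $F_{\phi,b}$ with data $(\phi,b)$. 2. For all $x\in\mathbb R$ and $a\in\mathcal M$, the values $F_{\phi,b}(x,1)$ converge, as the step function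 $b\in\mathcal M$ tends to $a$ in $L^1([0,1])$, to a real number; this limit is the Parisi functional $P_{\phi,x}(a)$. Moreover, $P_{\phi,x}(a)=F(x,1)$ for every solution $F$ with data $(\phi,a)$. 3. The Parisi functional is convex along one-sided directions: for all $x\in\mathbb R$, all $\alpha\in[0,1]$ and all $a_1,a_2\in\mathcal M$ with $a_1\le a_2$ on $[0,1]$, $$P_{\phi,x}(\alpha a_1+(1-\alpha)a_2)\le\alpha P_{\phi,x}(a_1)+(1-\alpha)P_{\phi,x}(a_2).$$ -/

import Mathlib

open Set MeasureTheory

namespace Parisi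

/-- The class `𝓒` of initial conditions: twice differentiable functions on `ℝ` with bounded first
and second derivatives (the second derivative need not be continuous). -/
structure InitialClass (φ : ℝ → ℝ) : Prop where
  differentiable : Differentiable ℝ φ
  differentiable_deriv : Differentiable ℝ (deriv φ)
  bounded_deriv : ∃ K : ℝ, ∀ x, |deriv φ x| ≤ K
  bounded_deriv_deriv : ∃ K : ℝ, ∀ x, |deriv (deriv φ) x| ≤ K

/-- The set `𝓜` of functional order parameters: nonincreasing, left-continuous functions from
`[0,1]` to `[0,1]`. They are represented by functions on `ℝ` of which only the restriction to
`[0,1]` matters. -/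
structure OrderParam (a : ℝ → ℝ) : Prop where
  mapsTo : MapsTo a (Icc 0 1) (Icc 0 1)
  antitoneOn : AntitoneOn a (Icc 0 1)
  left_continuous : ∀ t ∈ Ioc (0 : ℝ) 1, ContinuousWithinAt a (Icc 0 t) t

/-- The step functions in `𝓜`: the elements of `𝓜` that take only finitely many values. -/
structure StepOrderParam (a : ℝ → ℝ) : Prop extends OrderParam a where
  finite_image : (a '' Icc 0 1).Finite

/-- The `L¹([0,1])`-distance of two order parameters. -/
noncomputable def l1Dist (a b : ℝ → ℝ) : ℝ := ∫ t in (0 : ℝ)..1, |a t - b t|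

/-- The right-hand side `(1/2) (∂ₓₓF + a(t) (∂ₓF)²)` of the Parisi equation at `(x, t)`. -/
noncomputable def parisiRHS (a : ℝ → ℝ) (F : ℝ → ℝ → ℝ) (x t : ℝ) : ℝ :=
  (1 / 2) * (deriv (deriv fun y => F y t) x + a t * (deriv (fun y => F y t) x) ^ 2)

/-- `F` (that is, `(x, t) ↦ F x t` on `ℝ × [0,1]`) solves the Parisi equation
`∂ₜF = (1/2) (∂ₓₓF + a(t) (∂ₓF)²)` with initial condition `F(·, 0) = φ`.

Since `a` is left-continuous but may jump, the time derivative is the left derivative at every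
`t ∈ (0,1]`, and the usual two-sided one at every continuity point `t ∈ (0,1)` of `a`. The bound on
`∂ₓF` selects the solution: there is at most one with bounded gradient. -/
structure IsSolution (φ a : ℝ → ℝ) (F : ℝ → ℝ → ℝ) : Prop where
  continuousOn : ContinuousOn (fun p : ℝ × ℝ => F p.1 p.2) (univ ×ˢ Icc 0 1)
  initial : ∀ x, F x 0 = φ x
  contDiff : ∀ t ∈ Ioc (0 : ℝ) 1, ContDiff ℝ 2 fun x => F x t
  bounded_gradient : ∃ K : ℝ, ∀ t ∈ Ioc (0 : ℝ) 1, ∀ x, |deriv (fun y => F y t) x| ≤ K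
  equation_left : ∀ t ∈ Ioc (0 : ℝ) 1, ∀ x,
    HasDerivWithinAt (fun s => F x s) (parisiRHS a F x t) (Iic t) t
  equation : ∀ t ∈ Ioo (0 : ℝ) 1, ContinuousAt a t → ∀ x,
    HasDerivAt (fun s => F x s) (parisiRHS a F x t) t

/-- `v` is the limit of `F_{φ,b}(x, 1)` as the step function `b ∈ 𝓜` tends to `a` in `L¹([0,1])`,
where `F_{φ,b}` is the solution of the Parisi equation with parameter `b`. (If `a` is itself a step
function, `b = a` is allowed.) -/
def IsParisiValue (φ : ℝ → ℝ) (x : ℝ) (a : ℝ → ℝ) (v : ℝ) : Prop :=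
  ∀ ε > 0, ∃ δ > 0, ∀ b : ℝ → ℝ, StepOrderParam b → l1Dist a b < δ →
    ∀ F : ℝ → ℝ → ℝ, IsSolution φ b F → |F x 1 - v| < ε

/-- The Parisi functional `P_{φ,x}(a) = F_{φ,a}(x, 1)`, extended from step functions to all of `𝓜`
by `L¹`-continuity. -/
noncomputable def parisiFunctional (φ : ℝ → ℝ) (x : ℝ) (a : ℝ → ℝ) : ℝ :=
  Classical.epsilon (IsParisiValue φ x a)

end Parisi

/-! ### Comparison principle in doubled variables. -/

namespace Parisi

/-! Convexity comes from a maximum principle with the space variable doubled. Given solutions `F`,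
`F₁`, `F₂` with parameters `a`, `a₁`, `a₂`, look at α F₁(x,t) + (1-α) F₂(y,t) - F(αx + (1-α)y, t).
At a spatial minimum the first-order conditions make all three gradients equal to a common p, so the
quadratic terms of the equations combine to (α a₁ + (1-α) a₂ - a) p², which vanishes when a = α a₁ +
(1-α) a₂. The second-order condition in the direction (1,1) says that the second-derivative terms
combine to something nonnegative. Hence the minimum cannot become negative: it is nonnegative at
time 0 because φ is convex, and setting x = y at time 1 gives convexity in the parameter. A
quadratic penalty, growing exponentially in time, makes this rigorous on the unbounded domain
(`IsSolution.le_combination`).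

The same comparison, with an error term A(t), gives the rest of the analytic input. Comparing a
solution with its translates bounds the gradient by the Lipschitz constant L of φ
(`IsSolution.abs_deriv_le`). Comparing solutions with different parameters gives |F(x,1) - G(x,1)| ≤
L² ‖a - b‖₁ (`IsSolution.abs_sub_le`), hence uniqueness at time 1 and a continuous extension from
step functions.

For step functions, solutions are built one constancy interval at a time: where the parameter is a
constant m > 0, exp(mF) solves the heat equation (for m = 0, F itself does), and this Cole–Hopf step
preserves the Lipschitz constant (`StepOrderParam.exists_isSolution`). Rounding shows that step
functions are dense, so convexity passes to all parameters. -/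

/-- The second derivative is nonnegative at a local minimum. -/
theorem _root_.IsLocalMin.deriv_deriv_nonneg {f : ℝ → ℝ} {x : ℝ} (h : IsLocalMin f x)
    (hc : ContinuousAt f x) : 0 ≤ deriv (deriv f) x := by
  by_contra! hneg
  -- A negative second derivative would make `x` a local maximum as well, so `f` would be constant
  -- near `x`.
  have hmax : IsLocalMax f x := isLocalMax_of_deriv_deriv_neg hneg h.deriv_eq_zero hc
  have heq : f =ᶠ[nhds x] fun _ => f x := by
    filter_upwards [h, hmax] with y h1 h2 using le_antisymm h2 h1
  have : deriv (deriv f) x = 0 := by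
    rw [heq.deriv.deriv_eq]
    simp
  linarith

/-- If the left derivative at the right end point of an interval is `d` and the function attains
its minimum over the interval there, then `d ≤ 0`. -/
theorem hasDerivWithinAt_nonpos_of_isMin {f : ℝ → ℝ} {d t : ℝ} (ht : 0 < t)
    (hd : HasDerivWithinAt f d (Iic t) t) (hmin : ∀ s ∈ Icc 0 t, f t ≤ f s) : d ≤ 0 := by
  have h := (hasDerivWithinAt_iff_tendsto_slope.1 hd).mono_left
    (nhdsWithin_mono t (show Iio t ⊆ Iic t \ {t} from fun s hs => ⟨(mem_Iio.1 hs).le, (mem_Iio.1 hs).ne⟩))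
  refine le_of_tendsto h ?_
  filter_upwards [Ioo_mem_nhdsLT ht] with s hs
  rw [slope_def_field]
  exact div_nonpos_of_nonneg_of_nonpos (sub_nonneg.2 (hmin s ⟨hs.1.le, hs.2.le⟩))
    (sub_nonpos.2 hs.2.le)

theorem IsSolution.lipschitz {φ a : ℝ → ℝ} {F : ℝ → ℝ → ℝ} (hF : IsSolution φ a F) {K t : ℝ}
    (ht : t ∈ Ioc (0 : ℝ) 1) (hK : ∀ x, |deriv (fun y => F y t) x| ≤ K) (x y : ℝ) :
    |F x t - F y t| ≤ K * |x - y| := by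
  have := Convex.norm_image_sub_le_of_norm_deriv_le (f := fun y => F y t) (s := univ) (C := K)
    (x := y) (y := x)
    (fun z _ => ((hF.contDiff t ht).differentiable (by norm_num)).differentiableAt)
    (fun z _ => hK z) convex_univ trivial trivial
  simpa using this

theorem IsSolution.hasDerivAt {φ a : ℝ → ℝ} {F : ℝ → ℝ → ℝ} (hF : IsSolution φ a F) {t : ℝ}
    (ht : t ∈ Ioc (0 : ℝ) 1) (x : ℝ) :
    HasDerivAt (fun y => F y t) (deriv (fun y => F y t) x) x :=
  ((hF.contDiff t ht).differentiable (by norm_num)).differentiableAt.hasDerivAt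

theorem IsSolution.hasDerivAt_deriv {φ a : ℝ → ℝ} {F : ℝ → ℝ → ℝ} (hF : IsSolution φ a F) {t : ℝ}
    (ht : t ∈ Ioc (0 : ℝ) 1) (x : ℝ) :
    HasDerivAt (deriv fun y => F y t) (deriv (deriv fun y => F y t) x) x := by
  have h : ContDiff ℝ 1 (deriv fun y => F y t) :=
    ((contDiff_succ_iff_deriv (n := 1)).1 (hF.contDiff t ht)).2.2
  exact (h.differentiable (by norm_num)).differentiableAt.hasDerivAt

/-- Compactness of the time interval bounds `F 0 t`, and the gradient bound then gives linear growth
in space, uniformly in time. The quadratic penalty only has to beat this. -/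
theorem IsSolution.exists_bound {φ a : ℝ → ℝ} {F : ℝ → ℝ → ℝ} (hF : IsSolution φ a F) :
    ∃ K : ℝ, 0 ≤ K ∧ (∀ t ∈ Ioc (0 : ℝ) 1, ∀ x, |deriv (fun y => F y t) x| ≤ K) ∧
      ∀ t ∈ Ioc (0 : ℝ) 1, ∀ x, |F x t| ≤ K * (1 + |x|) := by
  obtain ⟨K, hK⟩ := hF.bounded_gradient
  have hc : ContinuousOn (fun t => F 0 t) (Icc 0 1) :=
    hF.continuousOn.comp (f := fun t : ℝ => ((0 : ℝ), t)) (by fun_prop) fun t ht => ⟨trivial, ht⟩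
  obtain ⟨C, hC⟩ := isCompact_Icc.exists_bound_of_continuousOn hc
  refine ⟨max K C ⊔ 0, le_max_right _ _, fun t ht x => (hK t ht x).trans (by simp),
    fun t ht x => ?_⟩
  have h1 := hF.lipschitz ht (hK t ht) x 0
  have h2 : |F 0 t| ≤ C := hC t ⟨ht.1.le, ht.2⟩
  have h3 : |F x t| ≤ |F x t - F 0 t| + |F 0 t| := by
    simpa using abs_add_le (F x t - F 0 t) (F 0 t)
  have h4 : K * |x| ≤ (max K C ⊔ 0) * |x| :=
    mul_le_mul_of_nonneg_right (by simp) (abs_nonneg x)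
  have h5 : C ≤ max K C ⊔ 0 := by simp
  rw [sub_zero] at h1
  linarith

/-- The pointwise inequality behind the comparison principle. -/
theorem penalised_derivative_pos {α a a₁ a₂ p p₁ p₂ q q₁ q₂ x y E K A : ℝ}
    (ha₁ : a₁ ∈ Icc (0 : ℝ) 1) (ha₂ : a₂ ∈ Icc (0 : ℝ) 1) (hE : 0 < E)
    (hp : |p| ≤ K) (hp₁ : |p₁| ≤ K) (hp₂ : |p₂| ≤ K)
    (hx : α * p₁ + 2 * E * x - α * p = 0) (hy : (1 - α) * p₂ + 2 * E * y - (1 - α) * p = 0)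
    (hq : 0 ≤ α * q₁ + (1 - α) * q₂ - q + 4 * E)
    (hA : (a - (α * a₁ + (1 - α) * a₂)) * p ^ 2 ≤ 2 * A) :
    0 < α * (1 / 2 * (q₁ + a₁ * p₁ ^ 2)) + (1 - α) * (1 / 2 * (q₂ + a₂ * p₂ ^ 2))
      - 1 / 2 * (q + a * p ^ 2) + A + (3 + 2 * K) * E * (1 + x ^ 2 + y ^ 2) := by
  have hK : 0 ≤ K := (abs_nonneg p).trans hp
  -- Factor r² - p² = (r - p)(r + p): the first-order condition turns β(r - p) into -2Ez, so unequal
  -- gradients cost only O(E).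
  have key : ∀ {β b r z : ℝ}, b ∈ Icc (0 : ℝ) 1 → |r| ≤ K →
      β * r + 2 * E * z - β * p = 0 → -(2 * E * K * (1 + z ^ 2)) ≤ β * (b * (r ^ 2 - p ^ 2)) := by
    intro β b r z hb hr hz
    have h1 : β * (b * (r ^ 2 - p ^ 2)) = -(2 * E * (b * (z * (r + p)))) := by
      have : β * (r - p) = -(2 * E * z) := by linarith
      linear_combination b * (r + p) * this
    have h2 : b * (z * (r + p)) ≤ K * (1 + z ^ 2) := by
      have h3 : |z * (r + p)| ≤ |z| * (2 * K) := by
        rw [abs_mul]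
        exact mul_le_mul_of_nonneg_left ((abs_add_le r p).trans (by linarith)) (abs_nonneg z)
      have h4 : |b * (z * (r + p))| ≤ |z * (r + p)| := by
        rw [abs_mul, abs_of_nonneg hb.1]
        exact mul_le_of_le_one_left (abs_nonneg _) hb.2
      have h5 : 2 * |z| ≤ 1 + z ^ 2 := by
        rw [← sq_abs z]; nlinarith [sq_nonneg (|z| - 1)]
      have h6 := le_abs_self (b * (z * (r + p)))
      nlinarith
    rw [h1]
    nlinarith
  have k1 := key ha₁ hp₁ hx
  have k2 := key ha₂ hp₂ hy
  have k3 : 0 ≤ E * x ^ 2 := by positivity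
  have k4 : 0 ≤ E * y ^ 2 := by positivity
  have k5 : 0 ≤ E * K * x ^ 2 := by positivity
  have k6 : 0 ≤ E * K * y ^ 2 := by positivity
  -- The losses are 2E from the second derivatives and EK(1 + x²), EK(1 + y²) from the gradients.
  -- The rate 3 + 2K covers them and leaves at least E to spare.
  nlinarith

/-- The quadratic penalty dominates functions of linear growth. -/
theorem penalised_nonneg_of_large {α f f₁ f₂ x y A C M ε e : ℝ} (hα : α ∈ Ioo (0 : ℝ) 1)
    (hM0 : 0 ≤ M) (hε : 0 < ε) (he : 1 ≤ e) (h₁ : |f₁| ≤ M * (1 + |x|))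
    (h₂ : |f₂| ≤ M * (1 + |y|)) (h : |f| ≤ M * (1 + |α * x + (1 - α) * y|)) (hA : |A| ≤ C)
    (hm1 : 1 ≤ max |x| |y|) (hm2 : 4 * M + |2 * M + C| ≤ ε * max |x| |y|) :
    0 ≤ α * f₁ + (1 - α) * f₂ - f + A + ε * e * (1 + x ^ 2 + y ^ 2) := by
  obtain ⟨hα0, hα1⟩ := hα
  have e0 : |α * x + (1 - α) * y| ≤ |x| + |y| := by
    refine (abs_add_le _ _).trans ?_
    rw [abs_mul, abs_mul, abs_of_pos hα0, abs_of_pos (sub_pos.2 hα1)]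
    nlinarith [abs_nonneg x, abs_nonneg y]
  have e1 := neg_le_of_abs_le h₁
  have e2 := neg_le_of_abs_le h₂
  have e3 : f ≤ M * (1 + (|x| + |y|)) :=
    (le_of_abs_le h).trans (mul_le_mul_of_nonneg_left (by linarith) hM0)
  have e4 : -C ≤ A := neg_le_of_abs_le hA
  have e5 : -(M * (1 + |x| + |y|)) ≤ α * f₁ + (1 - α) * f₂ := by
    have h1 := mul_le_mul_of_nonneg_left e1 hα0.le
    have h2 := mul_le_mul_of_nonneg_left e2 (sub_pos.2 hα1).le
    have h3 : α * (M * |x|) ≤ M * |x| := mul_le_of_le_one_left (by positivity) hα1.le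
    have h4 : (1 - α) * (M * |y|) ≤ M * |y| :=
      mul_le_of_le_one_left (by positivity) (by linarith)
    linarith
  have e6 : ε * (1 + x ^ 2 + y ^ 2) ≤ ε * e * (1 + x ^ 2 + y ^ 2) :=
    mul_le_mul_of_nonneg_right (le_mul_of_one_le_right hε.le he) (by positivity)
  set m := max |x| |y| with hm
  have hx_m : |x| ≤ m := le_max_left _ _
  have hy_m : |y| ≤ m := le_max_right _ _
  have hm3 : m ^ 2 ≤ x ^ 2 + y ^ 2 := by
    rw [← sq_abs x, ← sq_abs y]
    rcases max_choice |x| |y| with h | h <;> rw [hm, h] <;>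
      linarith [sq_nonneg |x|, sq_nonneg |y|]
  have hm4 : (4 * M + |2 * M + C|) * m ≤ ε * m * m := mul_le_mul_of_nonneg_right hm2 (by linarith)
  have hm5 : ε * m ^ 2 ≤ ε * (x ^ 2 + y ^ 2) := mul_le_mul_of_nonneg_left hm3 hε.le
  have hm6 : |2 * M + C| ≤ |2 * M + C| * m := le_mul_of_one_le_right (abs_nonneg _) hm1
  have hm7 := le_abs_self (2 * M + C)
  have hm8 : M * |x| ≤ M * m := mul_le_mul_of_nonneg_left hx_m hM0
  have hm9 : M * |y| ≤ M * m := mul_le_mul_of_nonneg_left hy_m hM0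
  linarith

/-- Comparison principle in doubled variables: if `φ (α x + (1 - α) y) ≤ α φ₁ x + (1 - α) φ₂ y`
up to the error `A 0`, and `a ≤ α a₁ + (1 - α) a₂` up to an error controlled by `A'`, then the
solutions satisfy the same inequality up to the error `A t`. -/
theorem IsSolution.le_combination {α : ℝ} (hα : α ∈ Ioo (0 : ℝ) 1)
    {φ φ₁ φ₂ a a₁ a₂ A A' : ℝ → ℝ} {F F₁ F₂ : ℝ → ℝ → ℝ} (hF : IsSolution φ a F)
    (hF₁ : IsSolution φ₁ a₁ F₁) (hF₂ : IsSolution φ₂ a₂ F₂)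
    (ha₁ : MapsTo a₁ (Icc 0 1) (Icc 0 1)) (ha₂ : MapsTo a₂ (Icc 0 1) (Icc 0 1))
    (hAc : ContinuousOn A (Icc 0 1))
    (hAd : ∀ t ∈ Ioc (0 : ℝ) 1, HasDerivWithinAt A (A' t) (Iic t) t)
    (hA : ∀ t ∈ Ioc (0 : ℝ) 1, ∀ x,
      (a t - (α * a₁ t + (1 - α) * a₂ t)) * (deriv (fun y => F y t) x) ^ 2 ≤ 2 * A' t)
    (hφ : ∀ x y, φ (α * x + (1 - α) * y) ≤ α * φ₁ x + (1 - α) * φ₂ y + A 0)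
    {t : ℝ} (ht : t ∈ Icc (0 : ℝ) 1) (x y : ℝ) :
    F (α * x + (1 - α) * y) t ≤ α * F₁ x t + (1 - α) * F₂ y t + A t := by
  obtain ⟨K, hK0, hK, hKb⟩ := hF.exists_bound
  obtain ⟨K₁, hK₁0, hK₁, hKb₁⟩ := hF₁.exists_bound
  obtain ⟨K₂, hK₂0, hK₂, hKb₂⟩ := hF₂.exists_bound
  obtain ⟨CA, hCA⟩ := isCompact_Icc.exists_bound_of_continuousOn hAc
  set M := max K (max K₁ K₂) with hM
  have hMK : K ≤ M := le_max_left _ _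
  have hMK₁ : K₁ ≤ M := (le_max_left _ _).trans (le_max_right _ _)
  have hMK₂ : K₂ ≤ M := (le_max_right _ _).trans (le_max_right _ _)
  have hM0 : 0 ≤ M := hK0.trans hMK
  obtain ⟨hα0, hα1⟩ := hα
  set lam := 3 + 2 * M with hlam
  have hlam0 : 0 < lam := by positivity
  set G : ℝ → ℝ → ℝ → ℝ := fun x y t =>
    α * F₁ x t + (1 - α) * F₂ y t - F (α * x + (1 - α) * y) t + A t with hG
  -- The quadratic penalty confines the minimum to a bounded region. The rate `lam` makes the
  -- penalty's time derivative outweigh every error that the penalty causes in the equations.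
  suffices H : ∀ ε > 0, 0 ≤ G x y t + ε * Real.exp (lam * t) * (1 + x ^ 2 + y ^ 2) by
    have : 0 ≤ G x y t := by
      refine le_of_forall_pos_le_add fun δ hδ => ?_
      have hpos : 0 < Real.exp (lam * t) * (1 + x ^ 2 + y ^ 2) := by positivity
      have := H (δ / (Real.exp (lam * t) * (1 + x ^ 2 + y ^ 2))) (by positivity)
      rwa [mul_assoc, div_mul_cancel₀ _ hpos.ne'] at this
    simp only [hG] at this
    linarith
  intro ε hε
  by_contra! hneg
  set H : ℝ → ℝ → ℝ → ℝ := fun x y t =>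
    G x y t + ε * Real.exp (lam * t) * (1 + x ^ 2 + y ^ 2) with hH
  have hH0 : ∀ x y, 0 ≤ H x y 0 := by
    intro x y
    have := hφ x y
    have h2 : 0 ≤ ε * Real.exp (lam * 0) * (1 + x ^ 2 + y ^ 2) := by positivity
    simp only [hH, hG, hF.initial, hF₁.initial, hF₂.initial]
    linarith
  -- coercivity
  obtain ⟨R, hR1, hR⟩ : ∃ R : ℝ, (|x| < R ∧ |y| < R) ∧
      ∀ x y t, t ∈ Icc (0 : ℝ) 1 → (R ≤ |x| ∨ R ≤ |y|) → 0 ≤ H x y t := by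
    set B := 2 * M + CA with hB
    refine ⟨max (max |x| |y| + 1) (max 1 ((4 * M + |B|) / ε)), ⟨?_, ?_⟩, ?_⟩
    · exact lt_max_of_lt_left (lt_add_of_le_of_pos (le_max_left _ _) one_pos)
    · exact lt_max_of_lt_left (lt_add_of_le_of_pos (le_max_right _ _) one_pos)
    intro x y t ht hxy
    rcases ht.1.eq_or_lt with rfl | ht0
    · exact hH0 x y
    have ht' : t ∈ Ioc (0 : ℝ) 1 := ⟨ht0, ht.2⟩
    have hRm : max 1 ((4 * M + |B|) / ε) ≤ max |x| |y| := by
      rcases hxy with h | h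
      · exact (le_max_right _ _).trans (h.trans (le_max_left _ _))
      · exact (le_max_right _ _).trans (h.trans (le_max_right _ _))
    have := penalised_nonneg_of_large ⟨hα0, hα1⟩ hM0 hε
      (Real.one_le_exp (by positivity : 0 ≤ lam * t))
      ((hKb₁ t ht' x).trans (mul_le_mul_of_nonneg_right hMK₁ (by positivity)))
      ((hKb₂ t ht' y).trans (mul_le_mul_of_nonneg_right hMK₂ (by positivity)))
      ((hKb t ht' (α * x + (1 - α) * y)).trans (mul_le_mul_of_nonneg_right hMK (by positivity)))
      (hCA t ht) ((le_max_left _ _).trans hRm)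
      (by rw [← div_le_iff₀' hε]; exact (le_max_right _ _).trans hRm)
    exact this
  -- the minimum
  have hHc : ContinuousOn (fun p : ℝ × ℝ × ℝ => H p.1 p.2.1 p.2.2)
      (univ ×ˢ univ ×ˢ Icc (0 : ℝ) 1) := by
    have c1 : ContinuousOn (fun p : ℝ × ℝ × ℝ => F₁ p.1 p.2.2) (univ ×ˢ univ ×ˢ Icc (0 : ℝ) 1) :=
      hF₁.continuousOn.comp (f := fun p : ℝ × ℝ × ℝ => (p.1, p.2.2)) (by fun_prop)
        fun p hp => ⟨trivial, hp.2.2⟩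
    have c2 : ContinuousOn (fun p : ℝ × ℝ × ℝ => F₂ p.2.1 p.2.2)
        (univ ×ˢ univ ×ˢ Icc (0 : ℝ) 1) :=
      hF₂.continuousOn.comp (f := fun p : ℝ × ℝ × ℝ => (p.2.1, p.2.2)) (by fun_prop)
        fun p hp => ⟨trivial, hp.2.2⟩
    have c3 : ContinuousOn (fun p : ℝ × ℝ × ℝ => F (α * p.1 + (1 - α) * p.2.1) p.2.2)
        (univ ×ˢ univ ×ˢ Icc (0 : ℝ) 1) :=
      hF.continuousOn.comp (f := fun p : ℝ × ℝ × ℝ => (α * p.1 + (1 - α) * p.2.1, p.2.2))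
        (by fun_prop) fun p hp => ⟨trivial, hp.2.2⟩
    have c4 : ContinuousOn (fun p : ℝ × ℝ × ℝ => A p.2.2) (univ ×ˢ univ ×ˢ Icc (0 : ℝ) 1) :=
      hAc.comp (f := fun p : ℝ × ℝ × ℝ => p.2.2) (by fun_prop) fun p hp => hp.2.2
    exact ((((c1.const_mul α).add (c2.const_mul (1 - α))).sub c3).add c4).add
      (Continuous.continuousOn (by fun_prop))
  obtain ⟨⟨x₀, y₀, t₀⟩, ⟨hx₀, hy₀, ht₀⟩, hmin⟩ :=
    (isCompact_Icc.prod (isCompact_Icc.prod isCompact_Icc) :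
      IsCompact (Icc (-R) R ×ˢ Icc (-R) R ×ˢ Icc (0 : ℝ) 1)).exists_isMinOn
      ⟨(x, y, t), ⟨abs_le.1 hR1.1.le, abs_le.1 hR1.2.le, ht⟩⟩
      (hHc.mono (prod_mono (subset_univ _) (prod_mono (subset_univ _) subset_rfl)))
  have hmin' : ∀ x ∈ Icc (-R) R, ∀ y ∈ Icc (-R) R, ∀ t ∈ Icc (0 : ℝ) 1, H x₀ y₀ t₀ ≤ H x y t :=
    fun x hx y hy t ht => hmin (show (x, y, t) ∈ _ from ⟨hx, hy, ht⟩)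
  have hneg₀ : H x₀ y₀ t₀ < 0 :=
    (hmin' x (abs_le.1 hR1.1.le) y (abs_le.1 hR1.2.le) t ht).trans_lt hneg
  have ht₀' : t₀ ∈ Ioc (0 : ℝ) 1 := by
    refine ⟨ht₀.1.lt_of_ne ?_, ht₀.2⟩
    rintro rfl
    exact hneg₀.not_ge (hH0 x₀ y₀)
  have hxR : x₀ ∈ Ioo (-R) R := by
    by_contra h
    exact hneg₀.not_ge (hR x₀ y₀ t₀ ht₀ (Or.inl (not_lt.1 fun h' => h (abs_lt.1 h'))))
  have hyR : y₀ ∈ Ioo (-R) R := by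
    by_contra h
    exact hneg₀.not_ge (hR x₀ y₀ t₀ ht₀ (Or.inr (not_lt.1 fun h' => h (abs_lt.1 h'))))
  set z₀ := α * x₀ + (1 - α) * y₀ with hz₀
  set E := ε * Real.exp (lam * t₀) with hE
  have hE0 : 0 < E := by positivity
  -- derivatives along a line in space
  have hline : ∀ (v w s : ℝ), HasDerivAt (fun s => H (x₀ + s * v) (y₀ + s * w) t₀)
      (α * (deriv (fun y => F₁ y t₀) (x₀ + s * v) * v)
        + (1 - α) * (deriv (fun y => F₂ y t₀) (y₀ + s * w) * w)
        - deriv (fun y => F y t₀) (α * (x₀ + s * v) + (1 - α) * (y₀ + s * w))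
          * (α * v + (1 - α) * w)
        + E * (2 * (x₀ + s * v) * v + 2 * (y₀ + s * w) * w)) s := by
    intro v w s
    have l1 : HasDerivAt (fun s => x₀ + s * v) v s := by
      simpa using ((hasDerivAt_id s).mul_const v).const_add x₀
    have l2 : HasDerivAt (fun s => y₀ + s * w) w s := by
      simpa using ((hasDerivAt_id s).mul_const w).const_add y₀
    have d1 := ((hF₁.hasDerivAt ht₀' (x₀ + s * v)).comp s l1).const_mul α
    have d2 := ((hF₂.hasDerivAt ht₀' (y₀ + s * w)).comp s l2).const_mul (1 - α)
    have d3 := (hF.hasDerivAt ht₀' (α * (x₀ + s * v) + (1 - α) * (y₀ + s * w))).comp s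
      ((l1.const_mul α).add (l2.const_mul (1 - α)))
    have d4 := (((l1.pow 2).const_add 1).add (l2.pow 2)).const_mul E
    refine ((((d1.add d2).sub d3).add_const (A t₀)).add d4).congr_deriv ?_
    simp
  have hloc : ∀ v w : ℝ, IsLocalMin (fun s => H (x₀ + s * v) (y₀ + s * w) t₀) 0 := by
    intro v w
    have c1 : ContinuousAt (fun s : ℝ => x₀ + s * v) 0 := by fun_prop
    have c2 : ContinuousAt (fun s : ℝ => y₀ + s * w) 0 := by fun_prop
    filter_upwards [c1.eventually_mem (s := Icc (-R) R) (Icc_mem_nhds (by simpa using hxR.1)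
      (by simpa using hxR.2)), c2.eventually_mem (s := Icc (-R) R)
      (Icc_mem_nhds (by simpa using hyR.1) (by simpa using hyR.2))] with s h1 h2
    simpa using hmin' _ h1 _ h2 t₀ ht₀
  -- First-order conditions in x and y: up to the penalty, both gradients agree with that of `F`.
  have hx1 := (hloc 1 0).hasDerivAt_eq_zero (hline 1 0 0)
  have hy1 := (hloc 0 1).hasDerivAt_eq_zero (hline 0 1 0)
  -- Along (1,1) the point αx + (1-α)y also moves at unit speed, so the second derivatives appear
  -- with exactly the weights α, 1-α and -1 of the equations. The penalty adds 4E.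
  have hq := (hloc 1 1).deriv_deriv_nonneg (hline 1 1 0).continuousAt
  rw [funext fun s => (hline 1 1 s).deriv] at hq
  have hdd : HasDerivAt (fun s => (α * (deriv (fun y => F₁ y t₀) (x₀ + s * 1) * 1)
        + (1 - α) * (deriv (fun y => F₂ y t₀) (y₀ + s * 1) * 1)
        - deriv (fun y => F y t₀) (α * (x₀ + s * 1) + (1 - α) * (y₀ + s * 1))
          * (α * 1 + (1 - α) * 1)
        + E * (2 * (x₀ + s * 1) * 1 + 2 * (y₀ + s * 1) * 1)))
      (α * deriv (deriv fun y => F₁ y t₀) x₀ + (1 - α) * deriv (deriv fun y => F₂ y t₀) y₀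
        - deriv (deriv fun y => F y t₀) z₀ + 4 * E) 0 := by
    have l1 : HasDerivAt (fun s : ℝ => x₀ + s * 1) 1 0 := by
      simpa using (hasDerivAt_id (0 : ℝ)).const_add x₀
    have l2 : HasDerivAt (fun s : ℝ => y₀ + s * 1) 1 0 := by
      simpa using (hasDerivAt_id (0 : ℝ)).const_add y₀
    have d1 := (((hF₁.hasDerivAt_deriv ht₀' (x₀ + 0 * 1)).comp 0 l1).mul_const 1).const_mul α
    have d2 := (((hF₂.hasDerivAt_deriv ht₀' (y₀ + 0 * 1)).comp 0 l2).mul_const 1).const_mul (1 - α)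
    have d3 := ((hF.hasDerivAt_deriv ht₀' (α * (x₀ + 0 * 1) + (1 - α) * (y₀ + 0 * 1))).comp 0
      ((l1.const_mul α).add (l2.const_mul (1 - α)))).mul_const (α * 1 + (1 - α) * 1)
    have d4 := (((l1.const_mul 2).mul_const 1).add ((l2.const_mul 2).mul_const 1)).const_mul E
    refine (((d1.add d2).sub d3).add d4).congr_deriv ?_
    simp only [hz₀]
    ring_nf
  rw [hdd.deriv] at hq
  -- derivative in time
  have htime : HasDerivWithinAt (fun s => H x₀ y₀ s)
      (α * parisiRHS a₁ F₁ x₀ t₀ + (1 - α) * parisiRHS a₂ F₂ y₀ t₀ - parisiRHS a F z₀ t₀ + A' t₀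
        + lam * E * (1 + x₀ ^ 2 + y₀ ^ 2)) (Iic t₀) t₀ := by
    have d1 := (hF₁.equation_left t₀ ht₀' x₀).const_mul α
    have d2 := (hF₂.equation_left t₀ ht₀' y₀).const_mul (1 - α)
    have d3 := hF.equation_left t₀ ht₀' z₀
    have l : HasDerivAt (fun s => lam * s) lam t₀ := by
      simpa using (hasDerivAt_id t₀).const_mul lam
    have d4 := ((l.exp.const_mul ε).mul_const (1 + x₀ ^ 2 + y₀ ^ 2)).hasDerivWithinAt
      (s := Iic t₀)
    refine ((((d1.add d2).sub d3).add (hAd t₀ ht₀')).add d4).congr_deriv ?_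
    rw [hE]
    ring
  -- Minimality against earlier times makes the left time derivative nonpositive, while `hpos` makes
  -- it strictly positive.
  have hle := hasDerivWithinAt_nonpos_of_isMin ht₀'.1 htime fun s hs =>
    hmin' x₀ hx₀ y₀ hy₀ s ⟨hs.1, hs.2.trans ht₀.2⟩
  have hpos := penalised_derivative_pos (x := x₀) (y := y₀) (ha₁ ht₀) (ha₂ ht₀) hE0
    ((hK t₀ ht₀' z₀).trans hMK) ((hK₁ t₀ ht₀' x₀).trans hMK₁) ((hK₂ t₀ ht₀' y₀).trans hMK₂)
    (by simp only [add_zero, mul_one, mul_zero] at hx1; rw [hz₀]; linarith)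
    (by simp only [add_zero, mul_one, mul_zero] at hy1; rw [hz₀]; linarith)
    hq (hA t₀ ht₀' z₀)
  simp only [parisiRHS] at hle
  linarith

end Parisi

/-! ### Gaussian integrals and the heat semigroup. -/

namespace Parisi

open Real

/-- Continuous functions growing more slowly than every Gaussian. -/
structure SubGaussianGrowth (w : ℝ → ℝ) : Prop where
  continuous : Continuous w
  bound : ∀ b > 0, ∃ C : ℝ, 0 ≤ C ∧ ∀ y, |w y| ≤ C * exp (b * y ^ 2)

/-- Differentiating the Gaussian kernel produces factors of y, so the class must be closed under
this product. Half of the exponent absorbs the extra |y|. -/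
theorem SubGaussianGrowth.id_mul {w : ℝ → ℝ} (hw : SubGaussianGrowth w) :
    SubGaussianGrowth fun y => y * w y := by
  refine ⟨continuous_id.mul hw.continuous, fun b hb => ?_⟩
  obtain ⟨C, hC0, hC⟩ := hw.bound (b / 2) (by positivity)
  refine ⟨(1 + 2 / b) * C, by positivity, fun y => ?_⟩
  have h1 : |y| ≤ (1 + 2 / b) * exp (b / 2 * y ^ 2) := by
    have h2 : b / 2 * y ^ 2 + 1 ≤ exp (b / 2 * y ^ 2) := add_one_le_exp _
    have h3 : |y| ≤ 1 + y ^ 2 := by rw [← sq_abs y]; nlinarith [sq_nonneg (|y| - 1), abs_nonneg y]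
    have h4 : (1 + 2 / b) * (b / 2 * y ^ 2 + 1) = (b / 2 * y ^ 2 + 1) + y ^ 2 + 2 / b := by
      field_simp
      ring
    have h5 : 0 ≤ 2 / b := by positivity
    have h6 : 0 ≤ b / 2 * y ^ 2 := by positivity
    have := mul_le_mul_of_nonneg_left h2 (by positivity : 0 ≤ 1 + 2 / b)
    linarith
  calc |y * w y| = |y| * |w y| := abs_mul _ _
    _ ≤ (1 + 2 / b) * exp (b / 2 * y ^ 2) * (C * exp (b / 2 * y ^ 2)) :=
      mul_le_mul h1 (hC y) (abs_nonneg _) (by positivity)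
    _ = (1 + 2 / b) * C * (exp (b / 2 * y ^ 2) * exp (b / 2 * y ^ 2)) := by ring
    _ = (1 + 2 / b) * C * exp (b * y ^ 2) := by rw [← exp_add]; ring_nf

/-- Complete the square: c|y| ≤ c²/(4b) + b y². -/
theorem SubGaussianGrowth.of_exp_bound {w : ℝ → ℝ} (hw : Continuous w) {C c : ℝ} (hC : 0 ≤ C)
    (h : ∀ y, |w y| ≤ C * exp (c * |y|)) : SubGaussianGrowth w := by
  refine ⟨hw, fun b hb => ⟨C * exp (c ^ 2 / (4 * b)), by positivity, fun y => (h y).trans ?_⟩⟩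
  rw [mul_assoc, ← exp_add]
  refine mul_le_mul_of_nonneg_left (exp_le_exp.2 ?_) hC
  have h1 : c ^ 2 / (4 * b) + b * y ^ 2 - c * |y| = (c / 2 - b * |y|) ^ 2 / b := by
    rw [← sq_abs y]
    field_simp
    ring
  have h2 : 0 ≤ (c / 2 - b * |y|) ^ 2 / b := by positivity
  linarith

/-- Since (2x - y)² ≥ 0, the kernel keeps half of its Gaussian decay in y, at a cost depending only
on x. The bound is uniform for τ near τ₀ and bounded x. -/
theorem exp_neg_sq_div_le {τ₀ τ x y X : ℝ} (hτ₀ : 0 < τ₀) (hτ : τ ∈ Icc (τ₀ / 2) (2 * τ₀))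
    (hx : |x| ≤ X) :
    exp (-(x - y) ^ 2 / (2 * τ)) ≤ exp (X ^ 2 / τ₀) * exp (-(1 / (8 * τ₀)) * y ^ 2) := by
  have hτ0 : 0 < τ := lt_of_lt_of_le (by positivity) hτ.1
  rw [← exp_add]
  refine exp_le_exp.2 ?_
  have h1 : -(x - y) ^ 2 / (2 * τ) ≤ x ^ 2 / (2 * τ) - y ^ 2 / (4 * τ) := by
    rw [← sub_nonneg]
    have : x ^ 2 / (2 * τ) - y ^ 2 / (4 * τ) - -(x - y) ^ 2 / (2 * τ)
        = (2 * x - y) ^ 2 / (4 * τ) := by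
      field_simp
      ring
    rw [this]
    positivity
  have h2 : x ^ 2 / (2 * τ) ≤ X ^ 2 / τ₀ :=
    div_le_div₀ (by positivity) (sq_le_sq' (by linarith [neg_le_of_abs_le hx])
      (le_of_abs_le hx)) hτ₀ (by linarith [hτ.1])
  have h3 : y ^ 2 / (8 * τ₀) ≤ y ^ 2 / (4 * τ) :=
    div_le_div_of_nonneg_left (by positivity) (by positivity) (by linarith [hτ.2])
  have h4 : -(1 / (8 * τ₀)) * y ^ 2 = -(y ^ 2 / (8 * τ₀)) := by ring
  rw [h4]
  linarith

/-- The integral of `w` against an unnormalised Gaussian kernel of variance `τ`. -/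
noncomputable def gaussInt (w : ℝ → ℝ) (τ x : ℝ) : ℝ := ∫ y, w y * exp (-(x - y) ^ 2 / (2 * τ))

namespace SubGaussianGrowth

variable {w : ℝ → ℝ}

theorem exists_dominating (hw : SubGaussianGrowth w) {τ₀ : ℝ} (hτ₀ : 0 < τ₀) (X : ℝ) :
    ∃ B : ℝ → ℝ, Integrable B ∧ (∀ y, 0 ≤ B y) ∧ ∀ τ ∈ Icc (τ₀ / 2) (2 * τ₀), ∀ x, |x| ≤ X → ∀ y,
      |w y * exp (-(x - y) ^ 2 / (2 * τ))| ≤ B y := by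
  -- Half the decay rate 1/(8τ₀) of the kernel bound, so an integrable Gaussian remains.
  obtain ⟨C, hC0, hC⟩ := hw.bound (1 / (16 * τ₀)) (by positivity)
  refine ⟨fun y => C * exp (X ^ 2 / τ₀) * exp (-(1 / (16 * τ₀)) * y ^ 2),
    (integrable_exp_neg_mul_sq (by positivity)).const_mul _, fun y => by positivity,
    fun τ hτ x hx y => ?_⟩
  rw [abs_mul, abs_of_pos (exp_pos _)]
  calc |w y| * exp (-(x - y) ^ 2 / (2 * τ))
      ≤ C * exp (1 / (16 * τ₀) * y ^ 2)
          * (exp (X ^ 2 / τ₀) * exp (-(1 / (8 * τ₀)) * y ^ 2)) :=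
        mul_le_mul (hC y) (exp_neg_sq_div_le hτ₀ hτ hx) (exp_pos _).le (by positivity)
    _ = C * exp (X ^ 2 / τ₀)
          * (exp (1 / (16 * τ₀) * y ^ 2) * exp (-(1 / (8 * τ₀)) * y ^ 2)) := by ring
    _ = C * exp (X ^ 2 / τ₀) * exp (-(1 / (16 * τ₀)) * y ^ 2) := by
        rw [← exp_add]
        congr 2
        field_simp
        ring

theorem aestronglyMeasurable (hw : SubGaussianGrowth w) (τ x : ℝ) :
    AEStronglyMeasurable (fun y => w y * exp (-(x - y) ^ 2 / (2 * τ))) := by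
  have := hw.continuous
  exact Continuous.aestronglyMeasurable (by fun_prop)

theorem integrable (hw : SubGaussianGrowth w) {τ : ℝ} (hτ : 0 < τ) (x : ℝ) :
    Integrable fun y => w y * exp (-(x - y) ^ 2 / (2 * τ)) := by
  obtain ⟨B, hB, -, hle⟩ := hw.exists_dominating hτ |x|
  exact hB.mono' (hw.aestronglyMeasurable τ x)
    (Filter.Eventually.of_forall (hle τ ⟨by linarith, by linarith⟩ x le_rfl))

theorem hasDerivAt_gaussInt (hw : SubGaussianGrowth w) {τ : ℝ} (hτ : 0 < τ) (x : ℝ) :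
    HasDerivAt (gaussInt w τ)
      ((gaussInt (fun y => y * w y) τ x - x * gaussInt w τ x) / τ) x := by
  obtain ⟨B₀, hB₀, hp₀, hle₀⟩ := hw.exists_dominating hτ (|x| + 1)
  obtain ⟨B₁, hB₁, hp₁, hle₁⟩ := hw.id_mul.exists_dominating hτ (|x| + 1)
  have hτ' : τ ∈ Icc (τ / 2) (2 * τ) := ⟨by linarith, by linarith⟩
  have := (hasDerivAt_integral_of_dominated_loc_of_deriv_le (μ := volume)
    (F := fun x y => w y * exp (-(x - y) ^ 2 / (2 * τ)))
    (F' := fun x y => (y * w y * exp (-(x - y) ^ 2 / (2 * τ))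
      - x * (w y * exp (-(x - y) ^ 2 / (2 * τ)))) / τ)
    (bound := fun y => (B₁ y + (|x| + 1) * B₀ y) / τ)
    (Metric.ball_mem_nhds x one_pos)
    (Filter.Eventually.of_forall (hw.aestronglyMeasurable τ)) (hw.integrable hτ x)
    (((hw.id_mul.integrable hτ x).sub ((hw.integrable hτ x).const_mul x)).div_const τ).1
    (Filter.Eventually.of_forall fun y x' hx' => ?_)
    ((hB₁.add (hB₀.const_mul _)).div_const τ)
    (Filter.Eventually.of_forall fun y x' _ => ?_)).2
  · refine this.congr_deriv ?_
    rw [integral_div, integral_sub (hw.id_mul.integrable hτ x)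
      ((hw.integrable hτ x).const_mul x), integral_const_mul]
    rfl
  · have hx : |x'| ≤ |x| + 1 := by
      rw [Metric.mem_ball, Real.dist_eq] at hx'
      have := abs_add_le (x' - x) x
      rw [sub_add_cancel] at this
      linarith
    rw [norm_div, Real.norm_of_nonneg hτ.le]
    refine div_le_div_of_nonneg_right ((norm_sub_le _ _).trans (add_le_add ?_ ?_)) hτ.le
    · exact hle₁ τ hτ' x' hx y
    · rw [norm_mul]
      exact mul_le_mul hx (hle₀ τ hτ' x' hx y) (norm_nonneg _) (by positivity)
  · have h1 : HasDerivAt (fun x : ℝ => -(x - y) ^ 2 / (2 * τ)) (-(2 * (x' - y)) / (2 * τ)) x' := by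
      refine ((((hasDerivAt_id x').sub_const y).pow 2).neg.div_const (2 * τ)).congr_deriv ?_
      simp
    refine (h1.exp.const_mul (w y)).congr_deriv ?_
    field_simp
    ring

theorem hasDerivAt_gaussInt_time (hw : SubGaussianGrowth w) {τ : ℝ} (hτ : 0 < τ) (x : ℝ) :
    HasDerivAt (fun s => gaussInt w s x)
      ((gaussInt (fun y => y * (y * w y)) τ x - 2 * x * gaussInt (fun y => y * w y) τ x
        + x ^ 2 * gaussInt w τ x) / (2 * τ ^ 2)) τ := by
  obtain ⟨B₀, hB₀, hp₀, hle₀⟩ := hw.exists_dominating hτ |x|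
  obtain ⟨B₁, hB₁, hp₁, hle₁⟩ := hw.id_mul.exists_dominating hτ |x|
  obtain ⟨B₂, hB₂, hp₂, hle₂⟩ := hw.id_mul.id_mul.exists_dominating hτ |x|
  have i₀ := (hw.integrable hτ x).const_mul (x ^ 2)
  have i₁ := (hw.id_mul.integrable hτ x).const_mul (2 * x)
  have i₂ := hw.id_mul.id_mul.integrable hτ x
  have i₂₁ : Integrable fun y => y * (y * w y) * exp (-(x - y) ^ 2 / (2 * τ))
      - 2 * x * (y * w y * exp (-(x - y) ^ 2 / (2 * τ))) := i₂.sub i₁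
  have := (hasDerivAt_integral_of_dominated_loc_of_deriv_le (μ := volume)
    (F := fun s y => w y * exp (-(x - y) ^ 2 / (2 * s)))
    (F' := fun s y => (y * (y * w y) * exp (-(x - y) ^ 2 / (2 * s))
      - 2 * x * (y * w y * exp (-(x - y) ^ 2 / (2 * s)))
      + x ^ 2 * (w y * exp (-(x - y) ^ 2 / (2 * s)))) / (2 * s ^ 2))
    (bound := fun y => (B₂ y + |2 * x| * B₁ y + |x ^ 2| * B₀ y) / (2 * (τ / 2) ^ 2))
    (Icc_mem_nhds (by linarith : τ / 2 < τ) (by linarith : τ < 2 * τ))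
    (Filter.Eventually.of_forall fun s => hw.aestronglyMeasurable s x) (hw.integrable hτ x)
    ((i₂₁.add i₀).div_const _).1
    (Filter.Eventually.of_forall fun y s hs => ?_)
    (((hB₂.add (hB₁.const_mul _)).add (hB₀.const_mul _)).div_const _)
    (Filter.Eventually.of_forall fun y s hs => ?_)).2
  · refine this.congr_deriv ?_
    rw [integral_div, integral_add i₂₁ i₀, integral_sub i₂ i₁, integral_const_mul,
      integral_const_mul]
    rfl
  · have hs0 : 0 < s := lt_of_lt_of_le (by positivity) hs.1
    rw [norm_div, Real.norm_of_nonneg (by positivity : 0 ≤ 2 * s ^ 2)]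
    have hb : 0 ≤ B₂ y + |2 * x| * B₁ y + |x ^ 2| * B₀ y :=
      add_nonneg (add_nonneg (hp₂ y) (mul_nonneg (abs_nonneg _) (hp₁ y)))
        (mul_nonneg (abs_nonneg _) (hp₀ y))
    refine div_le_div₀ hb ((norm_add_le _ _).trans
      (add_le_add ((norm_sub_le _ _).trans (add_le_add ?_ ?_)) ?_)) (by positivity) ?_
    · exact hle₂ s hs x le_rfl y
    · rw [norm_mul]
      exact mul_le_mul_of_nonneg_left (hle₁ s hs x le_rfl y) (abs_nonneg _)
    · rw [norm_mul]
      exact mul_le_mul_of_nonneg_left (hle₀ s hs x le_rfl y) (abs_nonneg _)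
    · have := hs.1
      gcongr
  · have hs0 : 0 < s := lt_of_lt_of_le (by positivity) hs.1
    have h1 : HasDerivAt (fun s : ℝ => -(x - y) ^ 2 / (2 * s)) ((x - y) ^ 2 / (2 * s ^ 2)) s := by
      refine ((hasDerivAt_const s (-(x - y) ^ 2)).div ((hasDerivAt_id s).const_mul 2)
        (by simpa using hs0.ne')).congr_deriv ?_
      simp only [id]
      field_simp
      ring
    refine (h1.exp.const_mul (w y)).congr_deriv ?_
    field_simp
    ring

/-- Each derivative is a combination of integrals of the same kind, with weights `w` and `y * w y`;
hence the induction is over all weights at once. -/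
theorem contDiff_gaussInt (hw : SubGaussianGrowth w) {τ : ℝ} (hτ : 0 < τ) (n : ℕ) :
    ContDiff ℝ n (gaussInt w τ) := by
  induction n generalizing w with
  | zero =>
    rw [Nat.cast_zero, contDiff_zero]
    exact continuous_iff_continuousAt.2 fun x => (hw.hasDerivAt_gaussInt hτ x).continuousAt
  | succ n ih =>
    rw [Nat.cast_succ, contDiff_succ_iff_deriv]
    refine ⟨fun x => (hw.hasDerivAt_gaussInt hτ x).differentiableAt, by simp, ?_⟩
    rw [funext fun x => (hw.hasDerivAt_gaussInt hτ x).deriv]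
    exact ((ih hw.id_mul).sub (contDiff_id.mul (ih hw))).div_const τ

end SubGaussianGrowth

/-- The heat semigroup: the expectation of `g (x + √τ Z)` for a standard Gaussian `Z`. -/
noncomputable def heat (g : ℝ → ℝ) (τ x : ℝ) : ℝ :=
  (√(2 * π))⁻¹ * ∫ z, g (x + √τ * z) * exp (-z ^ 2 / 2)

theorem integral_exp_neg_sq_div_two : ∫ z : ℝ, exp (-z ^ 2 / 2) = √(2 * π) := by
  have := integral_gaussian (1 / 2)
  rw [show π / (1 / 2) = 2 * π by ring] at this
  rw [← this]
  congr 1 with z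
  ring_nf

theorem heat_zero (g : ℝ → ℝ) (x : ℝ) : heat g 0 x = g x := by
  have : (√(2 * π)) ≠ 0 := by positivity
  simp only [heat, sqrt_zero, zero_mul, add_zero, integral_const_mul, integral_exp_neg_sq_div_two]
  field_simp

/-- The form with √τ z makes sense at τ = 0 and gives continuity there. The kernel form puts x and τ
in a smooth kernel, which can be differentiated even if `g` cannot. -/
theorem heat_eq_gaussInt (g : ℝ → ℝ) {τ : ℝ} (hτ : 0 < τ) (x : ℝ) :
    heat g τ x = (√(2 * π * τ))⁻¹ * gaussInt g τ x := by
  have hs : 0 < √τ := sqrt_pos.2 hτ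
  have h1 : gaussInt g τ x = ∫ y, g (x + y) * exp (-y ^ 2 / (2 * τ)) := by
    rw [gaussInt, ← integral_add_left_eq_self _ x]
    simp
  have h2 := Measure.integral_comp_mul_left (fun y => g (x + y) * exp (-y ^ 2 / (2 * τ))) (√τ)
  rw [h1, heat, sqrt_mul (by positivity : 0 ≤ 2 * π) τ, mul_inv, mul_assoc]
  congr 1
  rw [abs_of_pos (inv_pos.2 hs), smul_eq_mul] at h2
  rw [← h2]
  congr 1 with z
  rw [mul_pow, sq_sqrt hτ.le]
  congr 2
  field_simp

namespace SubGaussianGrowth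

variable {g : ℝ → ℝ}

theorem heat_bound (hg : SubGaussianGrowth g) (X T : ℝ) :
    ∃ B : ℝ → ℝ, Integrable B ∧ ∀ x τ, |x| ≤ X → √τ ≤ T → ∀ z,
      |g (x + √τ * z) * exp (-z ^ 2 / 2)| ≤ B z := by
  -- With this rate the growth of `g` at x + √τ z costs at most X² + z²/4 in the exponent, half of
  -- the available z²/2. The bound persists down to τ = 0.
  obtain ⟨C, hC0, hC⟩ := hg.bound (1 / (8 * (1 + T ^ 2))) (by positivity)
  refine ⟨fun z => C * exp (X ^ 2) * exp (-(1 / 4) * z ^ 2),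
    (integrable_exp_neg_mul_sq (by norm_num)).const_mul _, fun x τ hx hτ z => ?_⟩
  rw [abs_mul, abs_of_pos (exp_pos _)]
  refine (mul_le_mul_of_nonneg_right (hC _) (exp_pos _).le).trans ?_
  beta_reduce
  rw [mul_assoc, mul_assoc, ← exp_add, ← exp_add]
  refine mul_le_mul_of_nonneg_left (exp_le_exp.2 ?_) hC0
  have h1 : x ^ 2 ≤ X ^ 2 := sq_le_sq' (by linarith [neg_le_of_abs_le hx]) (le_of_abs_le hx)
  have h2 : √τ ^ 2 ≤ T ^ 2 := by
    have := sqrt_nonneg τ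
    gcongr
  have h3 : (x + √τ * z) ^ 2 ≤ 2 * (X ^ 2 + T ^ 2 * z ^ 2) := by
    nlinarith [sq_nonneg (x - √τ * z), mul_le_mul_of_nonneg_right h2 (sq_nonneg z)]
  have h4 : 1 / (8 * (1 + T ^ 2)) * (x + √τ * z) ^ 2 ≤ X ^ 2 + z ^ 2 / 4 := by
    rw [one_div, inv_mul_le_iff₀ (by positivity)]
    nlinarith [mul_nonneg (sq_nonneg T) (sq_nonneg X), sq_nonneg z, sq_nonneg X]
  linarith

theorem heat_aestronglyMeasurable (hg : SubGaussianGrowth g) (x τ : ℝ) :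
    AEStronglyMeasurable fun z => g (x + √τ * z) * exp (-z ^ 2 / 2) := by
  have := hg.continuous
  exact Continuous.aestronglyMeasurable (by fun_prop)

theorem heat_integrable (hg : SubGaussianGrowth g) (x τ : ℝ) :
    Integrable fun z => g (x + √τ * z) * exp (-z ^ 2 / 2) := by
  obtain ⟨B, hB, hle⟩ := hg.heat_bound |x| (√τ)
  exact hB.mono' (hg.heat_aestronglyMeasurable x τ)
    (Filter.Eventually.of_forall (hle x τ le_rfl le_rfl))

theorem continuous_heat (hg : SubGaussianGrowth g) :
    Continuous fun p : ℝ × ℝ => heat g p.2 p.1 := by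
  refine continuous_const.mul (continuous_iff_continuousAt.2 fun p => ?_)
  obtain ⟨B, hB, hle⟩ := hg.heat_bound (|p.1| + 1) (√p.2 + 1)
  have e1 : ∀ᶠ q : ℝ × ℝ in nhds p, |q.1| < |p.1| + 1 :=
    (by fun_prop : Continuous fun q : ℝ × ℝ => |q.1|).continuousAt.eventually_lt_const (by simp)
  have e2 : ∀ᶠ q : ℝ × ℝ in nhds p, √q.2 < √p.2 + 1 :=
    (by fun_prop : Continuous fun q : ℝ × ℝ => √q.2).continuousAt.eventually_lt_const (by simp)
  refine continuousAt_of_dominated (bound := B)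
    (Filter.Eventually.of_forall fun q => hg.heat_aestronglyMeasurable q.1 q.2) ?_ hB
    (Filter.Eventually.of_forall fun z => ?_)
  · filter_upwards [e1, e2] with q h1 h2
    exact Filter.Eventually.of_forall (hle q.1 q.2 h1.le h2.le)
  · have := hg.continuous
    fun_prop

/-- Monotonicity of the Gaussian average. The case c = 1 transports additive bounds on `f`, and d =
0 transports multiplicative bounds on exp(mf). -/
theorem heat_le (hg : SubGaussianGrowth g) {c d τ x y : ℝ}
    (h : ∀ z, g (x + z) ≤ c * g (y + z) + d) : heat g τ x ≤ c * heat g τ y + d := by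
  have hi : Integrable fun z : ℝ => exp (-z ^ 2 / 2) := by
    have := integrable_exp_neg_mul_sq (b := 1 / 2) (by norm_num)
    refine this.congr (Filter.Eventually.of_forall fun z => ?_)
    ring_nf
  have h1 : ∫ z, g (x + √τ * z) * exp (-z ^ 2 / 2) ≤
      c * (∫ z, g (y + √τ * z) * exp (-z ^ 2 / 2)) + d * √(2 * π) := by
    rw [← integral_exp_neg_sq_div_two, ← integral_const_mul, ← integral_const_mul,
      ← integral_add ((hg.heat_integrable y τ).const_mul c) (hi.const_mul d)]
    refine integral_mono (hg.heat_integrable x τ)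
      (((hg.heat_integrable y τ).const_mul c).add (hi.const_mul d)) fun z => ?_
    have := mul_le_mul_of_nonneg_right (h (√τ * z)) (exp_pos (-z ^ 2 / 2)).le
    simp only
    linarith
  have h2 := mul_le_mul_of_nonneg_left h1 (by positivity : 0 ≤ (√(2 * π))⁻¹)
  have h3 : (√(2 * π)) ≠ 0 := by positivity
  refine h2.trans_eq ?_
  rw [heat]
  field_simp

theorem heat_pos (hg : SubGaussianGrowth g) (hpos : ∀ x, 0 < g x) (τ x : ℝ) : 0 < heat g τ x := by
  refine mul_pos (by positivity) ?_
  rw [integral_pos_iff_support_of_nonneg (fun z => by have := hpos (x + √τ * z); positivity)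
    (hg.heat_integrable x τ)]
  have : Function.support (fun z => g (x + √τ * z) * exp (-z ^ 2 / 2)) = univ := by
    refine eq_univ_of_forall fun z => ?_
    exact (mul_pos (hpos _) (exp_pos _)).ne'
  rw [this]
  simp

theorem contDiff_heat (hg : SubGaussianGrowth g) {τ : ℝ} (hτ : 0 < τ) :
    ContDiff ℝ 2 (heat g τ) := by
  rw [funext fun x => heat_eq_gaussInt g hτ x]
  exact contDiff_const.mul (hg.contDiff_gaussInt hτ 2)

/-- The heat equation: both sides are the same combination of the Gaussian moments `I₀`, `I₁`, `I₂`.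
-/
theorem hasDerivAt_heat_time (hg : SubGaussianGrowth g) {τ : ℝ} (hτ : 0 < τ) (x : ℝ) :
    HasDerivAt (fun s => heat g s x) (1 / 2 * deriv (deriv (heat g τ)) x) τ := by
  set I₀ := gaussInt g τ with hI₀
  set I₁ := gaussInt (fun y => y * g y) τ with hI₁
  set I₂ := gaussInt (fun y => y * (y * g y)) τ with hI₂
  set k := (√(2 * π * τ))⁻¹ with hk
  have d1 : ∀ x, HasDerivAt (heat g τ) (k * ((I₁ x - x * I₀ x) / τ)) x := fun x => by
    rw [funext fun x => heat_eq_gaussInt g hτ x]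
    exact (hg.hasDerivAt_gaussInt hτ x).const_mul k
  have d2 : HasDerivAt (fun x => k * ((I₁ x - x * I₀ x) / τ))
      (k * (((I₂ x - x * I₁ x) / τ - (1 * I₀ x + x * ((I₁ x - x * I₀ x) / τ))) / τ)) x :=
    (((hg.id_mul.hasDerivAt_gaussInt hτ x).sub
      ((hasDerivAt_id x).mul (hg.hasDerivAt_gaussInt hτ x))).div_const τ).const_mul k
  rw [funext fun x => (d1 x).deriv, d2.deriv]
  have d3 : HasDerivAt (fun s => (√(2 * π * s))⁻¹) (-(k / (2 * τ))) τ := by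
    have hpos : 0 < 2 * π * τ := by positivity
    have hsq : 0 < √(2 * π * τ) := sqrt_pos.2 hpos
    refine ((((hasDerivAt_id τ).const_mul (2 * π)).sqrt hpos.ne').inv hsq.ne').congr_deriv ?_
    simp only [id, mul_one, hk]
    rw [sq_sqrt hpos.le]
    field_simp
  have d4 := d3.mul (hg.hasDerivAt_gaussInt_time hτ x)
  have heq : (fun s => heat g s x) =ᶠ[nhds τ]
      ((fun s => (√(2 * π * s))⁻¹) * fun s => gaussInt g s x) := by
    filter_upwards [lt_mem_nhds hτ] with s hs using heat_eq_gaussInt g hs x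
  refine (d4.congr_of_eventuallyEq heq).congr_deriv ?_
  simp only [← hI₀, ← hI₁, ← hI₂, ← hk]
  field_simp
  ring

end SubGaussianGrowth

end Parisi

/-! ### The Cole–Hopf formula and solutions for step functions. -/

namespace Parisi

open Real

/-- The Cole–Hopf solution of `∂ₜF = (1/2) (∂ₓₓF + m (∂ₓF)²)` with initial condition `f`. -/
noncomputable def coleHopf (m : ℝ) (f : ℝ → ℝ) (τ x : ℝ) : ℝ :=
  if m = 0 then heat f τ x else m⁻¹ * log (heat (fun y => exp (m * f y)) τ x)

section ColeHopf

variable {f : ℝ → ℝ} {L m : ℝ}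

theorem continuous_of_abs_sub_le (hf : ∀ x y, |f x - f y| ≤ L * |x - y|) : Continuous f := by
  have hL : 0 ≤ L := by simpa using (abs_nonneg _).trans (hf 1 0)
  refine (LipschitzWith.of_dist_le_mul (K := ⟨L, hL⟩) fun x y => ?_).continuous
  rw [Real.dist_eq, Real.dist_eq]
  exact hf x y

theorem abs_le_of_abs_sub_le (hf : ∀ x y, |f x - f y| ≤ L * |x - y|) (y : ℝ) :
    |f y| ≤ |f 0| + L * |y| := by
  have h1 := hf y 0
  have h2 := abs_add_le (f y - f 0) (f 0)
  rw [sub_add_cancel] at h2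
  rw [sub_zero] at h1
  linarith

theorem subGaussianGrowth_of_lipschitz (hf : ∀ x y, |f x - f y| ≤ L * |x - y|) :
    SubGaussianGrowth f := by
  have hL : 0 ≤ L := by simpa using (abs_nonneg _).trans (hf 1 0)
  refine .of_exp_bound (continuous_of_abs_sub_le hf) (C := |f 0| + L) (c := 1)
    (by positivity) fun y => ?_
  refine (abs_le_of_abs_sub_le hf y).trans ?_
  have h1 : |y| + 1 ≤ exp (1 * |y|) := by rw [one_mul]; exact add_one_le_exp _
  have h2 := mul_le_mul_of_nonneg_left h1 (by positivity : 0 ≤ |f 0| + L)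
  have h3 : 0 ≤ |f 0| * |y| := by positivity
  linarith

theorem subGaussianGrowth_exp_of_lipschitz (hf : ∀ x y, |f x - f y| ≤ L * |x - y|) (hm : 0 ≤ m) :
    SubGaussianGrowth fun y => exp (m * f y) := by
  have hc := continuous_of_abs_sub_le hf
  refine .of_exp_bound (by fun_prop) (C := exp (m * |f 0|)) (c := m * L) (exp_pos _).le fun y => ?_
  rw [abs_of_pos (exp_pos _), ← exp_add, mul_assoc, ← mul_add]
  exact exp_le_exp.2 (mul_le_mul_of_nonneg_left
    ((le_abs_self _).trans (abs_le_of_abs_sub_le hf y)) hm)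

theorem coleHopf_zero (m : ℝ) (f : ℝ → ℝ) (x : ℝ) : coleHopf m f 0 x = f x := by
  rw [coleHopf]
  split_ifs with h
  · exact heat_zero f x
  · rw [heat_zero, log_exp, inv_mul_cancel_left₀ h]

theorem continuous_coleHopf (hf : ∀ x y, |f x - f y| ≤ L * |x - y|) (hm : 0 ≤ m) :
    Continuous fun p : ℝ × ℝ => coleHopf m f p.2 p.1 := by
  simp only [coleHopf]
  split_ifs with h
  · exact (subGaussianGrowth_of_lipschitz hf).continuous_heat
  · have hg := subGaussianGrowth_exp_of_lipschitz hf hm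
    exact continuous_const.mul (hg.continuous_heat.log fun p =>
      (hg.heat_pos (fun x => exp_pos _) p.2 p.1).ne')

/-- Moving from y to x multiplies exp(mf) by at most exp(mL|x - y|), and m⁻¹ log turns this back
into L|x - y|. The constant does not deteriorate, so the step can be iterated. -/
theorem coleHopf_lipschitz (hf : ∀ x y, |f x - f y| ≤ L * |x - y|) (hm : 0 ≤ m) (τ x y : ℝ) :
    |coleHopf m f τ x - coleHopf m f τ y| ≤ L * |x - y| := by
  have key : ∀ x y, coleHopf m f τ x ≤ coleHopf m f τ y + L * |x - y| := by
    intro x y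
    have hz : ∀ z, f (x + z) ≤ f (y + z) + L * |x - y| := fun z => by
      have := le_of_abs_le (hf (x + z) (y + z))
      rw [add_sub_add_right_eq_sub] at this
      linarith
    simp only [coleHopf]
    split_ifs with h
    · have := (subGaussianGrowth_of_lipschitz hf).heat_le (c := 1) (d := L * |x - y|) (τ := τ)
        (x := x) (y := y) fun z => by rw [one_mul]; exact hz z
      rwa [one_mul] at this
    · have hm' : 0 < m := lt_of_le_of_ne hm (Ne.symm h)
      have hg := subGaussianGrowth_exp_of_lipschitz hf hm
      have h1 := hg.heat_le (c := exp (m * (L * |x - y|))) (d := 0) (τ := τ) (x := x) (y := y)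
        fun z => by
          rw [add_zero, ← exp_add, ← mul_add]
          exact exp_le_exp.2 (mul_le_mul_of_nonneg_left (by linarith [hz z]) hm)
      rw [add_zero] at h1
      have hpos := fun x => hg.heat_pos (fun x => exp_pos _) τ x
      have h2 := log_le_log (hpos x) h1
      rw [log_mul (exp_pos _).ne' (hpos y).ne', log_exp] at h2
      have h3 := mul_le_mul_of_nonneg_left h2 (inv_pos.2 hm').le
      rw [mul_add, inv_mul_cancel_left₀ h] at h3
      linarith
  have h1 := key x y
  have h2 := key y x
  rw [abs_sub_comm y x] at h2
  exact abs_le.2 ⟨by linarith, by linarith⟩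

theorem contDiff_coleHopf (hf : ∀ x y, |f x - f y| ≤ L * |x - y|) (hm : 0 ≤ m) {τ : ℝ}
    (hτ : 0 < τ) : ContDiff ℝ 2 (coleHopf m f τ) := by
  by_cases h : m = 0
  · have : coleHopf m f τ = heat f τ := funext fun x => if_pos h
    rw [this]
    exact (subGaussianGrowth_of_lipschitz hf).contDiff_heat hτ
  · have hg := subGaussianGrowth_exp_of_lipschitz hf hm
    have : coleHopf m f τ = fun x => m⁻¹ * log (heat (fun y => exp (m * f y)) τ x) :=
      funext fun x => if_neg h
    rw [this]
    exact contDiff_const.mul ((hg.contDiff_heat hτ).log fun x =>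
      (hg.heat_pos (fun x => exp_pos _) τ x).ne')

/-- For F = m⁻¹ log u, the term m F_x² cancels the -u_x²/u² part of F_xx. What remains is m⁻¹
u_xx/u, twice the time derivative by the heat equation for u. -/
theorem hasDerivAt_coleHopf_time (hf : ∀ x y, |f x - f y| ≤ L * |x - y|) (hm : 0 ≤ m) {τ : ℝ}
    (hτ : 0 < τ) (x : ℝ) :
    HasDerivAt (fun s => coleHopf m f s x)
      (1 / 2 * (deriv (deriv (coleHopf m f τ)) x + m * deriv (coleHopf m f τ) x ^ 2)) τ := by
  by_cases h : m = 0
  · have : coleHopf m f = heat f := funext fun τ => funext fun x => if_pos h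
    rw [this]
    simpa [h] using (subGaussianGrowth_of_lipschitz hf).hasDerivAt_heat_time hτ x
  · have hg := subGaussianGrowth_exp_of_lipschitz hf hm
    set u := heat (fun y => exp (m * f y)) with hu
    have hpos : ∀ x, u τ x ≠ 0 := fun x => (hg.heat_pos (fun x => exp_pos _) τ x).ne'
    have : coleHopf m f = fun τ x => m⁻¹ * log (u τ x) :=
      funext fun τ => funext fun x => if_neg h
    simp only [this]
    have hC := hg.contDiff_heat hτ
    have d1 : ∀ x, HasDerivAt (u τ) (deriv (u τ) x) x := fun x =>
      (hC.differentiable (by norm_num)).differentiableAt.hasDerivAt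
    have d2 : HasDerivAt (deriv (u τ)) (deriv (deriv (u τ)) x) x :=
      ((((contDiff_succ_iff_deriv (n := 1)).1 hC).2.2).differentiable
        (by norm_num)).differentiableAt.hasDerivAt
    have e1 : ∀ x, HasDerivAt (fun x => m⁻¹ * log (u τ x)) (m⁻¹ * (deriv (u τ) x / u τ x)) x :=
      fun x => ((d1 x).log (hpos x)).const_mul _
    have e2 : HasDerivAt (fun x => m⁻¹ * (deriv (u τ) x / u τ x))
        (m⁻¹ * ((deriv (deriv (u τ)) x * u τ x - deriv (u τ) x * deriv (u τ) x) / u τ x ^ 2)) x :=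
      (d2.div (d1 x) (hpos x)).const_mul _
    rw [funext fun x => (e1 x).deriv, e2.deriv]
    refine (((hg.hasDerivAt_heat_time hτ x).log (hpos x)).const_mul m⁻¹).congr_deriv ?_
    rw [← hu]
    have := hpos x
    field_simp
    ring

end ColeHopf

/-- A solution of the Parisi equation on `[0, T]` that is uniformly Lipschitz in space. -/
structure IsSolutionUpTo (φ b : ℝ → ℝ) (L T : ℝ) (F : ℝ → ℝ → ℝ) : Prop where
  continuousOn : ContinuousOn (fun p : ℝ × ℝ => F p.1 p.2) (univ ×ˢ Icc 0 T)
  initial : ∀ x, F x 0 = φ x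
  contDiff : ∀ t ∈ Ioc (0 : ℝ) T, ContDiff ℝ 2 fun x => F x t
  lipschitz : ∀ t ∈ Icc (0 : ℝ) T, ∀ x y, |F x t - F y t| ≤ L * |x - y|
  equation_left : ∀ t ∈ Ioc (0 : ℝ) T, ∀ x,
    HasDerivWithinAt (fun s => F x s) (parisiRHS b F x t) (Iic t) t
  equation : ∀ t ∈ Ioo (0 : ℝ) T, ContinuousAt b t → ∀ x,
    HasDerivAt (fun s => F x s) (parisiRHS b F x t) t

theorem IsSolutionUpTo.isSolution {φ b : ℝ → ℝ} {L : ℝ} {F : ℝ → ℝ → ℝ}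
    (h : IsSolutionUpTo φ b L 1 F) : IsSolution φ b F where
  continuousOn := h.continuousOn
  initial := h.initial
  contDiff := h.contDiff
  bounded_gradient := by
    have hL : 0 ≤ L := by
      simpa using (abs_nonneg _).trans (h.lipschitz 0 ⟨le_rfl, zero_le_one⟩ 1 0)
    refine ⟨L, fun t ht x => ?_⟩
    rw [← Real.norm_eq_abs]
    refine norm_deriv_le_of_lip' hL (Filter.Eventually.of_forall fun y => ?_)
    exact h.lipschitz t ⟨ht.1.le, ht.2⟩ y x
  equation_left := h.equation_left
  equation := h.equation

theorem isSolutionUpTo_zero {φ : ℝ → ℝ} {L : ℝ} (hφ : ∀ x y, |φ x - φ y| ≤ L * |x - y|)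
    (b : ℝ → ℝ) : IsSolutionUpTo φ b L 0 fun x _ => φ x where
  continuousOn := ((continuous_of_abs_sub_le hφ).comp continuous_fst).continuousOn
  initial _ := rfl
  contDiff t ht := absurd ht (by simp)
  lipschitz _ _ := hφ
  equation_left t ht := absurd ht (by simp)
  equation t ht := absurd ht (by simp)

/-- A solution up to time `s`, after which the parameter is constant and before which it is
strictly larger, extends by the Cole–Hopf formula. -/
theorem IsSolutionUpTo.extend {φ b : ℝ → ℝ} {L s T m : ℝ} {F : ℝ → ℝ → ℝ}
    (h : IsSolutionUpTo φ b L s F) (hs : 0 ≤ s) (hsT : s < T) (hm : 0 ≤ m)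
    (hb : ∀ t ∈ Ioc s T, b t = m) (hjump : 0 < s → m < b s) :
    ∃ F', IsSolutionUpTo φ b L T F' := by
  have hf : ∀ x y, |F x s - F y s| ≤ L * |x - y| := h.lipschitz s ⟨hs, le_rfl⟩
  set f : ℝ → ℝ := fun x => F x s with hf_def
  set F' : ℝ → ℝ → ℝ := fun x t => if t ≤ s then F x t else coleHopf m f (t - s) x with hF'
  have hle : ∀ x t, t ≤ s → F' x t = F x t := fun x t ht => if_pos ht
  have hge : ∀ x t, s ≤ t → F' x t = coleHopf m f (t - s) x := by
    intro x t ht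
    rcases ht.eq_or_lt with rfl | ht
    · rw [hle x s le_rfl, sub_self, coleHopf_zero]
    · exact if_neg ht.not_ge
  have hfle : ∀ t, t ≤ s → (fun x => F' x t) = fun x => F x t := fun t ht =>
    funext fun x => hle x t ht
  have hfge : ∀ t, s ≤ t → (fun x => F' x t) = coleHopf m f (t - s) := fun t ht =>
    funext fun x => hge x t ht
  have hRle : ∀ x t, t ≤ s → parisiRHS b F' x t = parisiRHS b F x t := fun x t ht => by
    simp only [parisiRHS, hfle t ht]
  have hderiv : ∀ t ∈ Ioc s T, ∀ x, HasDerivAt (fun r => F' x r) (parisiRHS b F' x t) t := by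
    intro t ht x
    have d := (hasDerivAt_coleHopf_time hf hm (sub_pos.2 ht.1) x).comp t
      ((hasDerivAt_id t).sub_const s)
    rw [mul_one] at d
    have heq : (fun r => F' x r) =ᶠ[nhds t]
        ((fun r => coleHopf m f r x) ∘ fun r => id r - s) := by
      filter_upwards [lt_mem_nhds ht.1] with r hr using hge x r hr.le
    refine (d.congr_of_eventuallyEq heq).congr_deriv ?_
    simp only [parisiRHS, hfge t ht.1.le, hb t ht, hf_def]
  refine ⟨F', ?_, ?_, ?_, ?_, ?_, ?_⟩
  · have c1 : ContinuousOn (fun p : ℝ × ℝ => F' p.1 p.2) (univ ×ˢ Icc 0 s) :=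
      h.continuousOn.congr fun p hp => hle p.1 p.2 hp.2.2
    have c2 : ContinuousOn (fun p : ℝ × ℝ => F' p.1 p.2) (univ ×ˢ Icc s T) := by
      refine ContinuousOn.congr (f := fun p : ℝ × ℝ => coleHopf m f (p.2 - s) p.1) ?_
        fun p hp => hge p.1 p.2 hp.2.1
      exact ((continuous_coleHopf hf hm).comp (g := fun p : ℝ × ℝ => coleHopf m f p.2 p.1)
        (f := fun p : ℝ × ℝ => (p.1, p.2 - s)) (by fun_prop)).continuousOn
    rw [← Icc_union_Icc_eq_Icc hs hsT.le, prod_union]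
    exact c1.union_of_isClosed c2 (isClosed_univ.prod isClosed_Icc)
      (isClosed_univ.prod isClosed_Icc)
  · intro x
    rw [hle x 0 hs, h.initial]
  · intro t ht
    rcases le_or_gt t s with hts | hts
    · rw [hfle t hts]
      exact h.contDiff t ⟨ht.1, hts⟩
    · rw [hfge t hts.le]
      exact contDiff_coleHopf hf hm (sub_pos.2 hts)
  · intro t ht x y
    rcases le_or_gt t s with hts | hts
    · rw [hle x t hts, hle y t hts]
      exact h.lipschitz t ⟨ht.1, hts⟩ x y
    · rw [hge x t hts.le, hge y t hts.le]
      exact coleHopf_lipschitz hf hm _ x y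
  · intro t ht x
    rcases le_or_gt t s with hts | hts
    · rw [hRle x t hts]
      exact (h.equation_left t ⟨ht.1, hts⟩ x).congr (fun r hr => hle x r (le_trans hr hts))
        (hle x t hts)
    · exact (hderiv t ⟨hts, ht.2⟩ x).hasDerivWithinAt
  · intro t ht hcont x
    rcases lt_trichotomy t s with hts | rfl | hts
    · rw [hRle x t hts.le]
      refine (h.equation t ⟨ht.1, hts⟩ hcont x).congr_of_eventuallyEq ?_
      filter_upwards [gt_mem_nhds hts] with r hr using hle x r hr.le
    -- At the gluing time the parameter jumps, so it is not continuous and no two-sided derivative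
    -- is required.
    · exfalso
      have h1 : Filter.Tendsto b (nhdsWithin t (Ioi t)) (nhds (b t)) :=
        hcont.mono_left nhdsWithin_le_nhds
      have h2 : Filter.Tendsto b (nhdsWithin t (Ioi t)) (nhds m) := by
        refine tendsto_const_nhds.congr' ?_
        filter_upwards [Ioc_mem_nhdsGT hsT] with r hr using (hb r hr).symm
      exact (hjump ht.1).ne (tendsto_nhds_unique h2 h1)
    · exact hderiv t ⟨hts, ht.2.le⟩ x

/-- The last jump before `T` of a step function. -/
theorem StepOrderParam.exists_last_jump {b : ℝ → ℝ} (hb : StepOrderParam b) {T : ℝ}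
    (hT : T ∈ Ioc (0 : ℝ) 1) :
    ∃ s, 0 ≤ s ∧ s < T ∧ (∀ t ∈ Ioc s T, b t = b T) ∧ (0 < s → b T < b s) := by
  have hT' : T ∈ Icc (0 : ℝ) 1 := ⟨hT.1.le, hT.2⟩
  -- Inserting 0 makes the supremum 0 when there is no earlier jump.
  set S : Set ℝ := insert 0 {t | t ∈ Ioc 0 T ∧ b T < b t} with hS
  have hSne : S.Nonempty := ⟨0, mem_insert _ _⟩
  have hST : ∀ t ∈ S, t ≤ T := by
    rintro t (rfl | ht)
    · exact hT.1.le
    · exact ht.1.2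
  have hSb : BddAbove S := ⟨T, hST⟩
  have hs0 : 0 ≤ sSup S := le_csSup hSb (mem_insert _ _)
  have hsT : sSup S ≤ T := csSup_le hSne hST
  have hjump : 0 < sSup S → b T < b (sSup S) := by
    intro hpos
    set s := sSup S with hs
    have hs1 : s ∈ Ioc (0 : ℝ) 1 := ⟨hpos, hsT.trans hT.2⟩
    -- The finitely many other values form a closed set, so by left continuity `b` equals `b s` just
    -- before s. Points of `S` accumulating at or attaining s then force `b T < b s`.
    have hcl : IsClosed (b '' Icc 0 1 \ {b s}) := (hb.finite_image.subset sdiff_subset).isClosed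
    have hev : ∀ᶠ t in nhdsWithin s (Icc 0 s), b t ∉ b '' Icc 0 1 \ {b s} :=
      (hb.left_continuous s hs1).eventually (hcl.isOpen_compl.eventually_mem (by simp))
    have hev' : ∀ᶠ t in nhdsWithin s (Iio s), b t ∉ b '' Icc 0 1 \ {b s} := by
      refine Filter.Eventually.filter_mono ?_ hev
      rw [← nhdsWithin_Ioo_eq_nhdsLT hpos]
      exact nhdsWithin_mono _ Ioo_subset_Icc_self
    obtain ⟨t, ht1, ht2⟩ := (hev'.and (Ioo_mem_nhdsLT hpos)).exists
    have ht01 : t ∈ Icc (0 : ℝ) 1 := ⟨ht2.1.le, ht2.2.le.trans hs1.2⟩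
    have hts : b t = b s := by
      by_contra hne
      exact ht1 ⟨mem_image_of_mem b ht01, hne⟩
    obtain ⟨t', ht', htt'⟩ := exists_lt_of_lt_csSup hSne ht2.2
    rcases ht' with rfl | ht'
    · exact absurd htt' ht2.1.not_gt
    · rw [← hts]
      exact ht'.2.trans_le (hb.antitoneOn ht01 ⟨ht'.1.1.le, ht'.1.2.trans hT.2⟩ htt'.le)
  refine ⟨sSup S, hs0, hsT.lt_of_ne fun h => ?_, fun t ht => ?_, hjump⟩
  · have := hjump (h ▸ hT.1)
    rw [h] at this
    exact this.false
  · have ht0 : 0 < t := hs0.trans_lt ht.1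
    refine le_antisymm (not_lt.1 fun hlt => ?_)
      (hb.antitoneOn ⟨ht0.le, ht.2.trans hT.2⟩ hT' ht.2)
    exact ht.1.not_ge (le_csSup hSb (mem_insert_of_mem _ ⟨⟨ht0, ht.2⟩, hlt⟩))

/-- Induction on the number of values on (0, T]: going back to the last jump drops the value `b T`,
and the Cole–Hopf formula bridges the interval in between. -/
theorem StepOrderParam.exists_isSolutionUpTo {φ b : ℝ → ℝ} {L : ℝ} (hb : StepOrderParam b)
    (hφ : ∀ x y, |φ x - φ y| ≤ L * |x - y|) (n : ℕ) :
    ∀ T ∈ Icc (0 : ℝ) 1, (b '' Ioc 0 T).ncard ≤ n → ∃ F, IsSolutionUpTo φ b L T F := by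
  have hfin : ∀ T ≤ (1 : ℝ), (b '' Ioc 0 T).Finite := fun T hT =>
    hb.finite_image.subset (image_mono fun t ht => ⟨ht.1.le, ht.2.trans hT⟩)
  induction n with
  | zero =>
    intro T hT hcard
    rw [Nat.le_zero, ncard_eq_zero (hfin T hT.2), image_eq_empty, Ioc_eq_empty_iff] at hcard
    obtain rfl : T = 0 := le_antisymm (not_lt.1 hcard) hT.1
    exact ⟨_, isSolutionUpTo_zero hφ b⟩
  | succ n ih =>
    intro T hT hcard
    rcases hT.1.eq_or_lt with rfl | hT0
    · exact ⟨_, isSolutionUpTo_zero hφ b⟩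
    obtain ⟨s, hs0, hsT, hconst, hjump⟩ := hb.exists_last_jump ⟨hT0, hT.2⟩
    have hs1 : s ≤ 1 := hsT.le.trans hT.2
    have hlt : (b '' Ioc 0 s).ncard < (b '' Ioc 0 T).ncard := by
      refine ncard_lt_ncard ⟨image_mono (Ioc_subset_Ioc_right hsT.le), fun hsub => ?_⟩
        (hfin T hT.2)
      obtain ⟨t, ht, hbt⟩ := hsub (mem_image_of_mem b (right_mem_Ioc.2 hT0))
      have h1 := hjump (ht.1.trans_le ht.2)
      have h2 := hb.antitoneOn ⟨ht.1.le, ht.2.trans hs1⟩ ⟨hs0, hs1⟩ ht.2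
      linarith
    obtain ⟨F, hF⟩ := ih s ⟨hs0, hs1⟩ (by omega)
    exact hF.extend hs0 hsT (hb.mapsTo hT).1 hconst hjump

theorem StepOrderParam.exists_isSolution {φ b : ℝ → ℝ} {L : ℝ} (hb : StepOrderParam b)
    (hφ : ∀ x y, |φ x - φ y| ≤ L * |x - y|) : ∃ F, IsSolution φ b F := by
  obtain ⟨F, hF⟩ := hb.exists_isSolutionUpTo hφ _ 1 ⟨zero_le_one, le_rfl⟩ le_rfl
  exact ⟨F, hF.isSolution⟩

end Parisi

/-! ### Gradient bound and dependence on the order parameter. -/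

namespace Parisi

/-- Translates in space of solutions are solutions. -/
theorem IsSolution.translate {φ a : ℝ → ℝ} {F : ℝ → ℝ → ℝ} (hF : IsSolution φ a F) (h : ℝ) :
    IsSolution (fun x => φ (x + h)) a fun x t => F (x + h) t where
  continuousOn := hF.continuousOn.comp (f := fun p : ℝ × ℝ => (p.1 + h, p.2)) (by fun_prop)
    fun p hp => ⟨trivial, hp.2⟩
  initial x := hF.initial (x + h)
  contDiff t ht := (hF.contDiff t ht).comp (contDiff_id.add contDiff_const)
  bounded_gradient := by
    obtain ⟨K, hK⟩ := hF.bounded_gradient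
    refine ⟨K, fun t ht x => ?_⟩
    rw [deriv_comp_add_const (fun y => F y t)]
    exact hK t ht (x + h)
  equation_left t ht x := by
    refine (hF.equation_left t ht (x + h)).congr_deriv ?_
    have : deriv (fun y => F (y + h) t) = fun y => deriv (fun y => F y t) (y + h) :=
      funext fun y => deriv_comp_add_const (fun y => F y t) h y
    simp only [parisiRHS, this, deriv_comp_add_const]
  equation t ht hc x := by
    refine (hF.equation t ht hc (x + h)).congr_deriv ?_
    have : deriv (fun y => F (y + h) t) = fun y => deriv (fun y => F y t) (y + h) :=
      funext fun y => deriv_comp_add_const (fun y => F y t) h y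
    simp only [parisiRHS, this, deriv_comp_add_const]

theorem _root_.ConvexOn.le_midpoint {φ : ℝ → ℝ} (hφ : ConvexOn ℝ univ φ) (x y : ℝ) :
    φ (1 / 2 * x + (1 - 1 / 2) * y) ≤ 1 / 2 * φ x + (1 - 1 / 2) * φ y :=
  hφ.2 trivial trivial (by norm_num) (by norm_num) (by norm_num)

/-- The gradient of a solution is bounded by the Lipschitz constant of its initial condition. -/
theorem IsSolution.abs_deriv_le {φ a : ℝ → ℝ} {F : ℝ → ℝ → ℝ} {L : ℝ} (hF : IsSolution φ a F)
    (ha : OrderParam a) (hconv : ConvexOn ℝ univ φ) (hφ : ∀ x y, |φ x - φ y| ≤ L * |x - y|)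
    {t : ℝ} (ht : t ∈ Ioc (0 : ℝ) 1) (x : ℝ) : |deriv (fun y => F y t) x| ≤ L := by
  have hL : 0 ≤ L := by simpa using (abs_nonneg _).trans (hφ 1 0)
  have key : ∀ x h, F (x + h) t ≤ F x t + L * |h| := by
    intro x h
    -- Using `F` for both copies and evaluating at x = y compares the translate with `F` itself. The
    -- initial inequality is still needed for x ≠ y, which is where convexity enters.
    have := (hF.translate h).le_combination (α := 1 / 2) (by norm_num) hF hF ha.mapsTo ha.mapsTo
      (A := fun _ => L * |h|) (A' := fun _ => 0) continuousOn_const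
      (fun t _ => hasDerivWithinAt_const _ _ _) (fun t _ x => le_of_eq (by ring)) (fun x y => ?_)
      (Ioc_subset_Icc_self ht) x x
    · rw [show 1 / 2 * x + (1 - 1 / 2) * x = x by ring] at this
      linarith
    · have h1 := hconv.le_midpoint x y
      have h2 := le_of_abs_le (hφ (1 / 2 * x + (1 - 1 / 2) * y + h) (1 / 2 * x + (1 - 1 / 2) * y))
      rw [add_sub_cancel_left] at h2
      linarith
  rw [← Real.norm_eq_abs]
  refine norm_deriv_le_of_lip' hL (Filter.Eventually.of_forall fun y => ?_)
  have h1 := key x (y - x)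
  have h2 := key y (x - y)
  rw [add_sub_cancel] at h1 h2
  rw [abs_sub_comm x y] at h2
  exact abs_le.2 ⟨by rw [Real.norm_eq_abs]; linarith, by rw [Real.norm_eq_abs]; linarith⟩

section Integrability

variable {a b : ℝ → ℝ}

theorem OrderParam.intervalIntegrable (ha : OrderParam a) :
    IntervalIntegrable a volume 0 1 := by
  refine AntitoneOn.intervalIntegrable ?_
  rw [uIcc_of_le zero_le_one]
  exact ha.antitoneOn

theorem OrderParam.intervalIntegrable_abs_sub (ha : OrderParam a) (hb : OrderParam b) :
    IntervalIntegrable (fun t => |a t - b t|) volume 0 1 :=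
  (ha.intervalIntegrable.sub hb.intervalIntegrable).abs

theorem l1Dist_triangle_left {c : ℝ → ℝ} (ha : OrderParam a) (hb : OrderParam b)
    (hc : OrderParam c) : l1Dist b c ≤ l1Dist a b + l1Dist a c := by
  rw [l1Dist, l1Dist, l1Dist, ← intervalIntegral.integral_add
    (ha.intervalIntegrable_abs_sub hb) (ha.intervalIntegrable_abs_sub hc)]
  refine intervalIntegral.integral_mono_on zero_le_one (hb.intervalIntegrable_abs_sub hc)
    ((ha.intervalIntegrable_abs_sub hb).add (ha.intervalIntegrable_abs_sub hc)) fun t _ => ?_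
  have := abs_sub_le (b t) (a t) (c t)
  rwa [abs_sub_comm (b t) (a t)] at this

theorem l1Dist_comm (a b : ℝ → ℝ) : l1Dist a b = l1Dist b a := by
  simp only [l1Dist, abs_sub_comm]

theorem l1Dist_le_of_abs_sub_le {ε : ℝ} (ha : OrderParam a) (hb : OrderParam b)
    (h : ∀ t ∈ Icc (0 : ℝ) 1, |a t - b t| ≤ ε) : l1Dist a b ≤ ε := by
  have := intervalIntegral.integral_mono_on zero_le_one (ha.intervalIntegrable_abs_sub hb)
    (intervalIntegrable_const (c := ε)) h
  simpa [l1Dist] using this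

/-- Left continuity of both parameters suffices for the left-sided fundamental theorem of calculus,
and the comparison principle uses only left derivatives of the error. -/
theorem OrderParam.hasDerivWithinAt_integral (ha : OrderParam a) (hb : OrderParam b) {t : ℝ}
    (ht : t ∈ Ioc (0 : ℝ) 1) :
    HasDerivWithinAt (fun s => ∫ r in (0 : ℝ)..s, |a r - b r|) |a t - b t| (Iic t) t := by
  have hint := ha.intervalIntegrable_abs_sub hb
  have hnhds : nhdsWithin t (Icc 0 t) = nhdsWithin t (Iic t) := nhdsWithin_Icc_eq_nhdsLE ht.1
  refine intervalIntegral.integral_hasDerivWithinAt_right (t := Iic t) (hint.mono_set ?_) ?_ ?_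
  · rw [uIcc_of_le ht.1.le, uIcc_of_le zero_le_one]
    exact Icc_subset_Icc_right ht.2
  · refine ⟨Ioc 0 t, ?_, ?_⟩
    · rw [← nhdsWithin_Ioc_eq_nhdsLE ht.1]
      exact self_mem_nhdsWithin
    · exact hint.1.aestronglyMeasurable.mono_measure (Measure.restrict_mono (Ioc_subset_Ioc_right ht.2) le_rfl)
  · rw [ContinuousWithinAt, ← hnhds]
    exact ((ha.left_continuous t ht).sub (hb.left_continuous t ht)).abs

end Integrability

/-- `L¹`-Lipschitz dependence of the solution on the order parameter, one-sided version. -/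
theorem IsSolution.sub_le {φ a b : ℝ → ℝ} {F G : ℝ → ℝ → ℝ} {L : ℝ} (hF : IsSolution φ a F)
    (hG : IsSolution φ b G) (ha : OrderParam a) (hb : OrderParam b) (hconv : ConvexOn ℝ univ φ)
    (hφ : ∀ x y, |φ x - φ y| ≤ L * |x - y|) (x : ℝ) :
    F x 1 - G x 1 ≤ L ^ 2 * l1Dist a b := by
  have hint := ha.intervalIntegrable_abs_sub hb
  -- The mismatch (a - b)(∂ₓF)² is at most L²|a - b| by the gradient bound, so L²∫|a - b| is an
  -- admissible error.
  have := hF.le_combination (α := 1 / 2) (by norm_num) hG hG hb.mapsTo hb.mapsTo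
    (A := fun s => L ^ 2 * ∫ r in (0 : ℝ)..s, |a r - b r|) (A' := fun t => L ^ 2 * |a t - b t|)
    ?_ (fun t ht => (ha.hasDerivWithinAt_integral hb ht).const_mul _) (fun t ht x => ?_)
    (fun x y => ?_) (right_mem_Icc.2 zero_le_one) x x
  · rw [show 1 / 2 * x + (1 - 1 / 2) * x = x by ring] at this
    rw [l1Dist]
    linarith
  · refine continuousOn_const.mul ?_
    have := intervalIntegral.continuousOn_primitive_interval (a := (0 : ℝ)) (b := 1)
      (μ := volume) (f := fun t => |a t - b t|) ?_
    · rwa [uIcc_of_le zero_le_one] at this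
    · rw [uIcc_of_le zero_le_one, integrableOn_Icc_iff_integrableOn_Ioc]
      exact hint.1
  · have h1 := hF.abs_deriv_le ha hconv hφ ht x
    have h2 : (deriv (fun y => F y t) x) ^ 2 ≤ L ^ 2 := sq_le_sq' (neg_le_of_abs_le h1)
      (le_of_abs_le h1)
    rw [show a t - (1 / 2 * b t + (1 - 1 / 2) * b t) = a t - b t by ring]
    have h3 := mul_le_mul_of_nonneg_right (le_abs_self (a t - b t))
      (sq_nonneg (deriv (fun y => F y t) x))
    have h4 := mul_le_mul_of_nonneg_left h2 (abs_nonneg (a t - b t))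
    have h5 : 0 ≤ |a t - b t| * L ^ 2 := by positivity
    linarith
  · rw [intervalIntegral.integral_same, mul_zero, add_zero]
    exact hconv.le_midpoint x y

theorem IsSolution.abs_sub_le {φ a b : ℝ → ℝ} {F G : ℝ → ℝ → ℝ} {L : ℝ} (hF : IsSolution φ a F)
    (hG : IsSolution φ b G) (ha : OrderParam a) (hb : OrderParam b) (hconv : ConvexOn ℝ univ φ)
    (hφ : ∀ x y, |φ x - φ y| ≤ L * |x - y|) (x : ℝ) :
    |F x 1 - G x 1| ≤ L ^ 2 * l1Dist a b := by
  have h1 := hF.sub_le hG ha hb hconv hφ x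
  have h2 := hG.sub_le hF hb ha hconv hφ x
  rw [l1Dist_comm] at h2
  exact abs_le.2 ⟨by linarith, by linarith⟩

/-! ### Density of step functions. -/

/-- Rounding down the values of an order parameter to multiples of `1 / n` gives a step function. -/
theorem OrderParam.exists_step {a : ℝ → ℝ} (ha : OrderParam a) {ε : ℝ} (hε : 0 < ε) :
    ∃ b, StepOrderParam b ∧ ∀ t ∈ Icc (0 : ℝ) 1, |a t - b t| ≤ ε := by
  obtain ⟨n, hn⟩ := exists_nat_gt ε⁻¹
  have hn0 : (0 : ℝ) < n := (inv_pos.2 hε).trans hn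
  refine ⟨fun t => (⌊n * a t⌋ : ℝ) / n, ⟨⟨?_, ?_, ?_⟩, ?_⟩, ?_⟩
  · intro t ht
    obtain ⟨h0, h1⟩ := ha.mapsTo ht
    refine ⟨div_nonneg ?_ hn0.le, (div_le_one hn0).2 ((Int.floor_le _).trans ?_)⟩
    · exact_mod_cast Int.floor_nonneg.2 (by positivity)
    · exact mul_le_of_le_one_right hn0.le h1
  · intro s hs t ht hst
    have := ha.antitoneOn hs ht hst
    have : ⌊n * a t⌋ ≤ ⌊n * a s⌋ := Int.floor_mono (mul_le_mul_of_nonneg_left this hn0.le)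
    simp only
    gcongr
  · intro t ht
    -- The floor is only right-continuous, but since `a` is nonincreasing, its values approach `a t`
    -- from above as s increases to t.
    have hmaps : MapsTo (fun s => n * a s) (Icc 0 t) (Ici (n * a t)) := fun s hs =>
      mul_le_mul_of_nonneg_left
        (ha.antitoneOn ⟨hs.1, hs.2.trans ht.2⟩ ⟨ht.1.le, ht.2⟩ hs.2) hn0.le
    have h1 : ContinuousWithinAt (fun s => n * a s) (Icc 0 t) t :=
      continuousWithinAt_const.mul (ha.left_continuous t ht)
    have h2 : ContinuousWithinAt (fun y : ℝ => (⌊y⌋ : ℝ)) (Ici (n * a t)) (n * a t) := by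
      have := (tendsto_floor_right_pure_floor (n * a t)).mono_right (pure_le_nhds _)
      exact (continuous_of_discreteTopology (f := fun k : ℤ => (k : ℝ))).continuousAt.tendsto.comp
        this
    exact (ContinuousWithinAt.comp (f := fun s => n * a s) (x := t) h2 h1 hmaps).div_const _
  · refine ((finite_Icc (0 : ℤ) (n : ℤ)).image fun k : ℤ => (k : ℝ) / n).subset ?_
    rintro _ ⟨t, ht, rfl⟩
    obtain ⟨h0, h1⟩ := ha.mapsTo ht
    refine ⟨⌊n * a t⌋, ⟨Int.floor_nonneg.2 (by positivity), ?_⟩, rfl⟩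
    have : (⌊n * a t⌋ : ℝ) ≤ n := (Int.floor_le _).trans (mul_le_of_le_one_right hn0.le h1)
    exact_mod_cast this
  · intro t _
    have h1 := Int.floor_le (n * a t)
    have h2 := Int.lt_floor_add_one (n * a t)
    have h3 : a t - (⌊n * a t⌋ : ℝ) / n = (n * a t - ⌊n * a t⌋) / n := by
      field_simp
    rw [h3, abs_of_nonneg (div_nonneg (by linarith) hn0.le), div_le_iff₀ hn0]
    have h4 : 1 < ε * n := by rwa [← inv_lt_iff_one_lt_mul₀' hε]
    linarith

theorem OrderParam.combination {a b : ℝ → ℝ} (ha : OrderParam a) (hb : OrderParam b)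
    {α : ℝ} (hα : α ∈ Icc (0 : ℝ) 1) : OrderParam fun t => α * a t + (1 - α) * b t := by
  have hα' : 0 ≤ 1 - α := sub_nonneg.2 hα.2
  refine ⟨fun t ht => ?_, fun s hs t ht hst => ?_, fun t ht => ?_⟩
  · exact convex_Icc (0 : ℝ) 1 (ha.mapsTo ht) (hb.mapsTo ht) hα.1 hα' (by ring)
  · exact add_le_add (mul_le_mul_of_nonneg_left (ha.antitoneOn hs ht hst) hα.1)
      (mul_le_mul_of_nonneg_left (hb.antitoneOn hs ht hst) hα')
  · exact (continuousWithinAt_const.mul (ha.left_continuous t ht)).add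
      (continuousWithinAt_const.mul (hb.left_continuous t ht))

theorem StepOrderParam.combination {a b : ℝ → ℝ} (ha : StepOrderParam a) (hb : StepOrderParam b)
    {α : ℝ} (hα : α ∈ Icc (0 : ℝ) 1) : StepOrderParam fun t => α * a t + (1 - α) * b t := by
  refine ⟨ha.toOrderParam.combination hb.toOrderParam hα,
    (Finite.image2 (fun u v => α * u + (1 - α) * v) ha.finite_image hb.finite_image).subset ?_⟩
  rintro _ ⟨t, ht, rfl⟩
  exact mem_image2_of_mem (mem_image_of_mem a ht) (mem_image_of_mem b ht)

theorem OrderParam.exists_step_l1Dist_lt {a : ℝ → ℝ} (ha : OrderParam a) {δ : ℝ} (hδ : 0 < δ) :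
    ∃ b, StepOrderParam b ∧ l1Dist a b < δ := by
  obtain ⟨b, hb, hab⟩ := ha.exists_step (half_pos hδ)
  exact ⟨b, hb, (l1Dist_le_of_abs_sub_le ha hb.toOrderParam hab).trans_lt (half_lt_self hδ)⟩

theorem InitialClass.exists_lipschitz {φ : ℝ → ℝ} (hφ : InitialClass φ) :
    ∃ L : ℝ, ∀ x y, |φ x - φ y| ≤ L * |x - y| := by
  obtain ⟨L, hL⟩ := hφ.bounded_deriv
  refine ⟨L, fun x y => ?_⟩
  simpa using Convex.norm_image_sub_le_of_norm_deriv_le (f := φ) (s := univ) (C := L)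
    (x := y) (y := x) (fun z _ => hφ.differentiable z) (fun z _ => hL z) convex_univ trivial trivial

/-! ### The Parisi functional: limit, uniqueness and convexity. -/

section Value

variable {φ a : ℝ → ℝ} {L x : ℝ}

theorem exists_isParisiValue (hconv : ConvexOn ℝ univ φ)
    (hφ : ∀ x y, |φ x - φ y| ≤ L * |x - y|) (ha : OrderParam a) (x : ℝ) :
    ∃ v, IsParisiValue φ x a v := by
  have hstep : ∀ n : ℕ, ∃ b, StepOrderParam b ∧ l1Dist a b < 1 / ((n : ℝ) + 1) := fun n =>
    ha.exists_step_l1Dist_lt Nat.one_div_pos_of_nat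
  choose b hb hab using hstep
  choose F hF using fun n => (hb n).exists_isSolution hφ
  have hlim : Filter.Tendsto (fun n : ℕ => l1Dist a (b n)) Filter.atTop (nhds 0) :=
    squeeze_zero (fun n => intervalIntegral.integral_nonneg zero_le_one fun t _ => abs_nonneg _)
      (fun n => (hab n).le) tendsto_one_div_add_atTop_nhds_zero_nat
  -- L may be 0; the extra 1 allows division.
  have hL : 0 < L ^ 2 + 1 := by positivity
  have hdist : ∀ c d G H, StepOrderParam c → StepOrderParam d → IsSolution φ c G →
      IsSolution φ d H → |G x 1 - H x 1| ≤ (L ^ 2 + 1) * (l1Dist a c + l1Dist a d) := by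
    intro c d G H hc hd hG hH
    refine (hG.abs_sub_le hH hc.toOrderParam hd.toOrderParam hconv hφ x).trans ?_
    have h0 : 0 ≤ l1Dist c d :=
      intervalIntegral.integral_nonneg zero_le_one fun t _ => abs_nonneg _
    have h1 := l1Dist_triangle_left ha hc.toOrderParam hd.toOrderParam
    have h2 := mul_le_mul_of_nonneg_left h1 hL.le
    linarith
  have hcauchy : CauchySeq fun n => F n x 1 := by
    rw [Metric.cauchySeq_iff]
    intro ε hε
    obtain ⟨N, hN⟩ := Filter.eventually_atTop.1
      (hlim.eventually_lt_const (show 0 < ε / (2 * (L ^ 2 + 1)) by positivity))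
    refine ⟨N, fun m hm n hn => ?_⟩
    rw [Real.dist_eq]
    refine (hdist _ _ _ _ (hb m) (hb n) (hF m) (hF n)).trans_lt ?_
    have h1 := mul_lt_mul_of_pos_left (add_lt_add (hN m hm) (hN n hn)) hL
    refine h1.trans_eq ?_
    field_simp
    ring
  obtain ⟨v, hv⟩ := cauchySeq_tendsto_of_complete hcauchy
  refine ⟨v, fun ε hε => ⟨ε / (2 * (L ^ 2 + 1)), by positivity, fun c hc hac G hG => ?_⟩⟩
  have h1 : Filter.Tendsto (fun n => |G x 1 - F n x 1|) Filter.atTop (nhds |G x 1 - v|) :=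
    (hv.const_sub _).abs
  have h2 : Filter.Tendsto (fun n => (L ^ 2 + 1) * (l1Dist a c + l1Dist a (b n))) Filter.atTop
      (nhds ((L ^ 2 + 1) * (l1Dist a c + 0))) := (hlim.const_add _).const_mul _
  have h3 := le_of_tendsto_of_tendsto' h1 h2 fun n => hdist _ _ _ _ hc (hb n) hG (hF n)
  have h4 := mul_lt_mul_of_pos_left hac hL
  have h5 : (L ^ 2 + 1) * (ε / (2 * (L ^ 2 + 1))) = ε / 2 := by field_simp
  rw [add_zero] at h3
  linarith

/-- Solvable step functions exist arbitrarily close to `a`, so the limit is not vacuous, and one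
such value lies close to both candidates. -/
theorem IsParisiValue.unique {v w : ℝ} (hφ : ∀ x y, |φ x - φ y| ≤ L * |x - y|)
    (ha : OrderParam a) (hv : IsParisiValue φ x a v) (hw : IsParisiValue φ x a w) : v = w := by
  refine eq_of_forall_dist_le fun ε hε => ?_
  rw [Real.dist_eq]
  obtain ⟨δ₁, hδ₁, h1⟩ := hv (ε / 2) (half_pos hε)
  obtain ⟨δ₂, hδ₂, h2⟩ := hw (ε / 2) (half_pos hε)
  obtain ⟨b, hb, hab⟩ := ha.exists_step_l1Dist_lt (lt_min hδ₁ hδ₂)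
  obtain ⟨F, hF⟩ := hb.exists_isSolution hφ
  have k1 := h1 b hb (hab.trans_le (min_le_left _ _)) F hF
  have k2 := h2 b hb (hab.trans_le (min_le_right _ _)) F hF
  have := abs_sub_le v (F x 1) w
  rw [abs_sub_comm v (F x 1)] at this
  linarith

theorem IsSolution.isParisiValue {F : ℝ → ℝ → ℝ} (hF : IsSolution φ a F) (ha : OrderParam a)
    (hconv : ConvexOn ℝ univ φ) (hφ : ∀ x y, |φ x - φ y| ≤ L * |x - y|) (x : ℝ) :
    IsParisiValue φ x a (F x 1) := by
  refine fun ε hε => ⟨ε / (L ^ 2 + 1), by positivity, fun b hb hab G hG => ?_⟩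
  have h1 := hF.abs_sub_le hG ha hb.toOrderParam hconv hφ x
  have h2 : 0 ≤ l1Dist a b :=
    intervalIntegral.integral_nonneg zero_le_one fun t _ => abs_nonneg _
  rw [lt_div_iff₀ (by positivity)] at hab
  rw [abs_sub_comm]
  linarith

theorem parisiFunctional_spec (hconv : ConvexOn ℝ univ φ)
    (hφ : ∀ x y, |φ x - φ y| ≤ L * |x - y|) (ha : OrderParam a) (x : ℝ) :
    IsParisiValue φ x a (parisiFunctional φ x a) :=
  Classical.epsilon_spec (exists_isParisiValue hconv hφ ha x)

/-- The Parisi functional of a convex initial condition is convex. -/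
theorem parisiFunctional_combination_le (hconv : ConvexOn ℝ univ φ)
    (hφ : ∀ x y, |φ x - φ y| ≤ L * |x - y|) {a₁ a₂ : ℝ → ℝ} (ha₁ : OrderParam a₁)
    (ha₂ : OrderParam a₂) {α : ℝ} (hα : α ∈ Icc (0 : ℝ) 1) (x : ℝ) :
    parisiFunctional φ x (fun t => α * a₁ t + (1 - α) * a₂ t) ≤
      α * parisiFunctional φ x a₁ + (1 - α) * parisiFunctional φ x a₂ := by
  rcases hα.1.eq_or_lt with rfl | hα0
  · simp
  rcases hα.2.eq_or_lt with rfl | hα1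
  · simp
  have ha := ha₁.combination ha₂ hα
  refine le_of_forall_pos_le_add fun ε hε => ?_
  obtain ⟨δ, hδ, h⟩ := parisiFunctional_spec hconv hφ ha x (ε / 2) (half_pos hε)
  obtain ⟨δ₁, hδ₁, h₁⟩ := parisiFunctional_spec hconv hφ ha₁ x (ε / 2) (half_pos hε)
  obtain ⟨δ₂, hδ₂, h₂⟩ := parisiFunctional_spec hconv hφ ha₂ x (ε / 2) (half_pos hε)
  -- A single uniform precision below all three L¹ thresholds; the combination of the two step
  -- functions inherits it.
  obtain ⟨η, hη, hηδ⟩ := exists_between (lt_min hδ (lt_min hδ₁ hδ₂))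
  rw [lt_min_iff, lt_min_iff] at hηδ
  obtain ⟨b₁, hb₁, hab₁⟩ := ha₁.exists_step hη
  obtain ⟨b₂, hb₂, hab₂⟩ := ha₂.exists_step hη
  have hb := hb₁.combination hb₂ hα
  have hab : ∀ t ∈ Icc (0 : ℝ) 1,
      |α * a₁ t + (1 - α) * a₂ t - (α * b₁ t + (1 - α) * b₂ t)| ≤ η := by
    intro t ht
    have e : α * a₁ t + (1 - α) * a₂ t - (α * b₁ t + (1 - α) * b₂ t)
        = α * (a₁ t - b₁ t) + (1 - α) * (a₂ t - b₂ t) := by ring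
    rw [e]
    refine (abs_add_le _ _).trans ?_
    rw [abs_mul, abs_mul, abs_of_pos hα0, abs_of_pos (sub_pos.2 hα1)]
    have k1 := mul_le_mul_of_nonneg_left (hab₁ t ht) hα0.le
    have k2 := mul_le_mul_of_nonneg_left (hab₂ t ht) (sub_pos.2 hα1).le
    linarith
  obtain ⟨F, hF⟩ := hb.exists_isSolution hφ
  obtain ⟨F₁, hF₁⟩ := hb₁.exists_isSolution hφ
  obtain ⟨F₂, hF₂⟩ := hb₂.exists_isSolution hφ
  have k := h _ hb ((l1Dist_le_of_abs_sub_le ha hb.toOrderParam hab).trans_lt hηδ.1) F hF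
  have k₁ := h₁ _ hb₁
    ((l1Dist_le_of_abs_sub_le ha₁ hb₁.toOrderParam hab₁).trans_lt hηδ.2.1) F₁ hF₁
  have k₂ := h₂ _ hb₂
    ((l1Dist_le_of_abs_sub_le ha₂ hb₂.toOrderParam hab₂).trans_lt hηδ.2.2) F₂ hF₂
  -- No error term: the step parameter of `F` is exactly the combination of the other two.
  have key := hF.le_combination ⟨hα0, hα1⟩ hF₁ hF₂ hb₁.mapsTo hb₂.mapsTo
    (A := fun _ => 0) (A' := fun _ => 0) continuousOn_const
    (fun t _ => hasDerivWithinAt_const _ _ _) (fun t _ x => le_of_eq (by ring))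
    (fun x y => by
      rw [add_zero]
      exact hconv.2 trivial trivial hα0.le (sub_pos.2 hα1).le (by ring))
    (right_mem_Icc.2 zero_le_one) x x
  rw [show α * x + (1 - α) * x = x by ring] at key
  have m := abs_lt.1 k
  have m₁ := mul_lt_mul_of_pos_left (abs_lt.1 k₁).2 hα0
  have m₂ := mul_lt_mul_of_pos_left (abs_lt.1 k₂).2 (sub_pos.2 hα1)
  linarith [m.1]

end Value

end Parisi

/-- Convexity of the Parisi functional along one-sided directions. The first three conjuncts say
that the functional is well defined: the equation is solvable for step functions, the values for
step functions converge in the `L¹` sense to `P_{φ,x}(a)`, and `P_{φ,x}(a) = F(x, 1)` for every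
solution `F` of the equation with parameter `a` (in particular whenever `a` is a step function). -/
theorem corollary1 (φ : ℝ → ℝ) (hφ : Parisi.InitialClass φ)
    (hconv : ConvexOn ℝ Set.univ φ) (hmono : Monotone φ ∨ Function.Even φ) :
    (∀ b : ℝ → ℝ, Parisi.StepOrderParam b → ∃ F : ℝ → ℝ → ℝ, Parisi.IsSolution φ b F) ∧
    (∀ a : ℝ → ℝ, Parisi.OrderParam a → ∀ x : ℝ,
      Parisi.IsParisiValue φ x a (Parisi.parisiFunctional φ x a)) ∧
    (∀ a : ℝ → ℝ, Parisi.OrderParam a → ∀ F : ℝ → ℝ → ℝ, Parisi.IsSolution φ a F →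
      ∀ x : ℝ, Parisi.parisiFunctional φ x a = F x 1) ∧
    (∀ a₁ a₂ : ℝ → ℝ, Parisi.OrderParam a₁ → Parisi.OrderParam a₂ →
      (∀ t ∈ Set.Icc (0 : ℝ) 1, a₁ t ≤ a₂ t) →
      ∀ α ∈ Set.Icc (0 : ℝ) 1, ∀ x : ℝ,
        Parisi.parisiFunctional φ x (fun t => α * a₁ t + (1 - α) * a₂ t) ≤
          α * Parisi.parisiFunctional φ x a₁ + (1 - α) * Parisi.parisiFunctional φ x a₂) := by
  obtain ⟨L, hL⟩ := hφ.exists_lipschitz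
  refine ⟨fun b hb => hb.exists_isSolution hL,
    fun a ha x => Parisi.parisiFunctional_spec hconv hL ha x, fun a ha F hF x => ?_,
    fun a₁ a₂ ha₁ ha₂ _ α hα x =>
      Parisi.parisiFunctional_combination_le hconv hL ha₁ ha₂ hα x⟩
  exact (Parisi.parisiFunctional_spec hconv hL ha x).unique hL ha
    (hF.isParisiValue ha hconv hL x)
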